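/- Throughout, theories are complete first-order theories in countable single-sorted languages, structures are non-empty, no model of a theory under consideration is a singleton, and "definable" means definable without parameters. A topological groupoid is a set $\mathbf{G}$ with a Hausdorff topology, a partial composition law and an inversion map, both continuous where defined, such that $(fg)h=f(gh)$ as soon as one of the two sides is defined, $g^{-1}g$ and $gg^{-1}$ are always defined, and, whenever $fg$ is defined, $fgg^{-1}=f$ and $f^{-1}fg=g$. An isomorphism of topological groupoids is a homeomorphism that preserves (the domain of) composition and inversion. Let $T$ be a theory in a language $\mathcal{L}$. A sequence $\Phi=(\varphi_n(x_{<n},y):n\in\mathbb{N})$ of $\mathcal{L}$-formulas, where $x_{<n}=(x_0,\dots,x_{n-1})$ and $y$ is a single variable, is called rich if every $\mathcal{L}$-formula $\varphi(x_{<k},y)$ appears (with dummy variables) as $\varphi_n$ for some $n\ge k$. For a rich sequence $\Phi$ and $M\models T$ let $D_\Phi(M)$ be the set of the sequences $a=(a_n)_{n\in\mathbb{N}}$ in $M$ with $$M\models \forall y\,\bigl[\varphi_k(a_{<k},y)\rightarrow\varphi_k(a_{<k},a_k)\bigr]\qquad\text{for all }k\in\mathbb{N}.$$ Let $\mathbf{G}_\Phi(T)$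 be the set of all types $\operatorname{tp}(a,b)$ where $a,b\in D_\Phi(M)$ are two enumerations of one countable model $M$ of $T$. With the topology induced from the space of complete types of $T$ in the variables $(x_n,y_n)_{n\in\mathbb{N}}$, and with the operations $\operatorname{tp}(a,b)\cdot\operatorname{tp}(b,c)=\operatorname{tp}(a,c)$ and $\operatorname{tp}(a,b)^{-1}=\operatorname{tp}(b,a)$, it is a topological groupoid. Two theories $T$ and $T'$ are bi-interpretable if there are interpretation schemes of $T'$ in $T$ and of $T$ in $T'$ (by definable quotients of definable sets of finite tuples) such that, when they are composed to yield an interpretation of $T$, or of $T'$, in itself, the models are uniformly definably isomorphic to their interpreted copies. Theorem. Let $T$ and $T'$ be bi-interpretable, and let $\Phi$ and $\Psi$ be rich sequences for the languages of $T$ and of $T'$, respectively. Then $\mathbf{G}_\Phi(T)$ and $\mathbf{G}_\Psi(T')$ are isomorphic as topological groupoids. In particular, for any theory $T$ and any two rich sequences $\Phi,\Phi'$ for its language, $\mathbf{G}_\Phi(T)\cong\mathbf{G}_{\Phi'}(T)$ as topological groupoids; so, up to isomorphism of topological groupoids, $\mathbf{G}_\Phi(T)$ does not depend on $\Phi$,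 and it only depends on $T$ up to bi-interpretation. -/

import Mathlib

open FirstOrder FirstOrder.Language

universe u v u' v'

/-! ### Topological groupoids -/

/-- A groupoid in the algebraic sense: a set with a partial composition law (the value `none` means
that the composition is not defined) and an inversion map. The neutral elements form its base. -/
class AlgGroupoid (G : Type*) where
  comp : G → G → Option G
  inv : G → G
  /-- `(f g) h = f (g h)` as soon as one of the two sides is defined. -/
  assoc : ∀ f g h : G,
    ((comp f g).bind fun k => comp k h) = ((comp g h).bind fun k => comp f k)
  inv_comp_isSome : ∀ g, (comp (inv g) g).isSome
  comp_inv_isSome : ∀ g, (comp g (inv g)).isSome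
  /-- If `f g` is defined, then `(f g) g⁻¹ = f`. -/
  comp_comp_inv : ∀ f g k, comp f g = some k → comp k (inv g) = some f
  /-- If `f g` is defined, then `f⁻¹ (f g) = g`. -/
  inv_comp_comp : ∀ f g k, comp f g = some k → comp (inv f) k = some g

/-- A topological groupoid: a groupoid with a Hausdorff topology for which inversion, and
composition on its domain, are continuous. -/
class IsTopologicalGroupoid (G : Type*) [TopologicalSpace G] [AlgGroupoid G] : Prop where
  t2 : T2Space G
  continuous_inv : Continuous (AlgGroupoid.inv : G → G)
  continuous_comp : Continuous
    fun p : {p : G × G // (AlgGroupoid.comp p.1 p.2).isSome} =>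
      (AlgGroupoid.comp p.1.1 p.1.2).get p.2

/-- An isomorphism of topological groupoids: a homeomorphism that respects the domain of
composition, composition, and inversion. -/
structure TopGroupoidIso (G H : Type*) [TopologicalSpace G] [AlgGroupoid G]
    [TopologicalSpace H] [AlgGroupoid H] extends G ≃ₜ H where
  map_comp : ∀ f g : G,
    AlgGroupoid.comp (toFun f) (toFun g) = (AlgGroupoid.comp f g).map toFun
  map_inv : ∀ g : G, toFun (AlgGroupoid.inv g) = AlgGroupoid.inv (toFun g)

/-! ### Rich sequences -/

/-- A sequence of formulas `φ_n(x_{<n}, y)`. -/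
abbrev FormulaSeq (L : FirstOrder.Language.{u, v}) := (n : ℕ) → L.Formula (Fin n ⊕ Unit)

/-- `Φ` is rich if every formula `φ(x_{<k}, y)` appears, with dummy variables, as `φ_n` for some
`n ≥ k`. -/
def FormulaSeq.IsRich {L : FirstOrder.Language.{u, v}} (Φ : FormulaSeq L) : Prop :=
  ∀ (k : ℕ) (φ : L.Formula (Fin k ⊕ Unit)),
    ∃ (n : ℕ) (h : k ≤ n), Φ n = φ.relabel (Sum.map (Fin.castLE h) id)

/-- The set `D_Φ(M)` of the sequences `a` in `M` such that, for every `k`, if there is a witness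
for `φ_k(a_{<k}, y)`, then `a_k` is one. -/
def FormulaSeq.D {L : FirstOrder.Language.{u, v}} (Φ : FormulaSeq L) (M : Type*) [L.Structure M] :
    Set (ℕ → M) :=
  {a | ∀ (k : ℕ) (y : M),
    (Φ k).Realize (Sum.elim (fun i : Fin k => a i) fun _ => y) →
      (Φ k).Realize (Sum.elim (fun i : Fin k => a i) fun _ => a k)}

/-! ### The groupoid of a theory -/

/-- `tp(a, b)` for two sequences `a`, `b` in a model of `T`. -/
def pairType {L : FirstOrder.Language.{u, v}} (T : L.Theory) (M : Theory.ModelType.{u, v, 0} T)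
    (a b : ℕ → M) : T.CompleteType (ℕ ⊕ ℕ) :=
  T.typeOf (Sum.elim a b)

/-- The set `G_Φ(T)` of all types `tp(a, b)`, where `a` and `b` are enumerations of one countable
model `M` of `T` that belong to `D_Φ(M)`. As a set of complete types it carries the subspace
topology of the space of types. -/
def GPhi {L : FirstOrder.Language.{u, v}} (T : L.Theory) (Φ : FormulaSeq L) :
    Set (T.CompleteType (ℕ ⊕ ℕ)) :=
  {p | ∃ (M : Theory.ModelType.{u, v, 0} T) (a b : ℕ → M),
    Function.Surjective a ∧ Function.Surjective b ∧ a ∈ Φ.D M ∧ b ∈ Φ.D M ∧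
      p = pairType T M a b}

/-- `g`, `h`, `k` are of the form `tp(a, b)`, `tp(b, c)`, `tp(a, c)` with `a`, `b`, `c` enumerations
of one model. -/
def GPhi.IsComp {L : FirstOrder.Language.{u, v}} {T : L.Theory} {Φ : FormulaSeq L} (g h k : GPhi T Φ) :
    Prop :=
  ∃ (M : Theory.ModelType.{u, v, 0} T) (a b c : ℕ → M),
    Function.Surjective a ∧ Function.Surjective b ∧ Function.Surjective c ∧
      (g : T.CompleteType (ℕ ⊕ ℕ)) = pairType T M a b ∧
      (h : T.CompleteType (ℕ ⊕ ℕ)) = pairType T M b c ∧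
      (k : T.CompleteType (ℕ ⊕ ℕ)) = pairType T M a c

/-- `k = tp(b, a)` where `g = tp(a, b)`. -/
def GPhi.IsInv {L : FirstOrder.Language.{u, v}} {T : L.Theory} {Φ : FormulaSeq L} (g k : GPhi T Φ) : Prop :=
  ∃ (M : Theory.ModelType.{u, v, 0} T) (a b : ℕ → M),
    Function.Surjective a ∧ Function.Surjective b ∧
      (g : T.CompleteType (ℕ ⊕ ℕ)) = pairType T M a b ∧
      (k : T.CompleteType (ℕ ⊕ ℕ)) = pairType T M b a

namespace GPhi

variable {L : FirstOrder.Language.{u, v}} {T : L.Theory} {Φ : FormulaSeq L}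

theorem typeOf_eq_iff {α : Type*} {M N : Theory.ModelType.{u, v, 0} T} {a : α → M} {b : α → N} :
    T.typeOf a = T.typeOf b ↔ ∀ φ : L.Formula α, φ.Realize a ↔ φ.Realize b := by
  constructor
  · intro h φ
    rw [← Theory.CompleteType.formula_mem_typeOf (T := T), h,
      Theory.CompleteType.formula_mem_typeOf]
  · intro h
    refine SetLike.ext fun φ => ?_
    rw [Theory.CompleteType.mem_typeOf, Theory.CompleteType.mem_typeOf]
    exact h _

theorem typeOf_comp {α β : Type*} {M N : Theory.ModelType.{u, v, 0} T} {a : α → M} {b : α → N}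
    (h : T.typeOf a = T.typeOf b) (f : β → α) : T.typeOf (a ∘ f) = T.typeOf (b ∘ f) := by
  rw [typeOf_eq_iff] at h ⊢
  intro φ
  have := h (φ.relabel f)
  rwa [Formula.realize_relabel, Formula.realize_relabel] at this

theorem typeOf_equiv {α : Type*} {M N : Theory.ModelType.{u, v, 0} T} (e : M ≃[L] N)
    (a : α → M) : T.typeOf (e ∘ a) = T.typeOf a := by
  rw [typeOf_eq_iff]
  intro φ
  exact StrongHomClass.realize_formula e φ

/-- Two enumerations with the same type differ by an isomorphism. -/
theorem exists_equiv {M N : Theory.ModelType.{u, v, 0} T} {a : ℕ → M} {b : ℕ → N}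
    (ha : Function.Surjective a) (hb : Function.Surjective b) (h : T.typeOf a = T.typeOf b) :
    ∃ e : M ≃[L] N, ∀ i, e (a i) = b i := by
  rw [typeOf_eq_iff] at h
  have heq : ∀ i j, a i = a j ↔ b i = b j := by
    intro i j
    have := h ((Term.var i).equal (Term.var j))
    simpa [Formula.realize_equal] using this
  choose s hs using ha
  choose r hr using hb
  let e0 : M ≃ N :=
    { toFun := fun x => b (s x)
      invFun := fun y => a (r y)
      left_inv := fun x => by
        have : b (r (b (s x))) = b (s x) := hr _
        exact ((heq _ _).2 this).trans (hs x)
      right_inv := fun y => by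
        have : a (s (a (r y))) = a (r y) := hs _
        exact ((heq _ _).1 this).trans (hr y) }
  have he : ∀ i, e0 (a i) = b i := fun i => (heq _ _).1 (hs (a i))
  refine ⟨{ e0 with map_fun' := ?_, map_rel' := ?_ }, he⟩
  · intro n f x
    obtain ⟨j, rfl⟩ : ∃ j : Fin n → ℕ, x = a ∘ j := ⟨s ∘ x, funext fun i => (hs _).symm⟩
    obtain ⟨k, hk⟩ : ∃ k, Structure.funMap f (a ∘ j) = a k := ⟨_, (hs _).symm⟩
    have := (h ((Term.func f fun i => Term.var (j i)).equal (Term.var k))).1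
      (by simpa [Formula.realize_equal, Function.comp_def] using hk)
    have h2 : Structure.funMap f (b ∘ j) = b k := by
      simpa [Formula.realize_equal, Function.comp_def] using this
    have h3 : e0 ∘ (a ∘ j) = b ∘ j := funext fun i => he _
    change e0 _ = Structure.funMap f (e0 ∘ (a ∘ j))
    rw [hk, he, h3, h2]
  · intro n R x
    obtain ⟨j, rfl⟩ : ∃ j : Fin n → ℕ, x = a ∘ j := ⟨s ∘ x, funext fun i => (hs _).symm⟩
    have := h (R.formula fun i => Term.var (j i))
    rw [Formula.realize_rel, Formula.realize_rel] at this
    have h3 : e0 ∘ (a ∘ j) = b ∘ j := funext fun i => he _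
    change Structure.RelMap R (e0 ∘ (a ∘ j)) ↔ _
    rw [h3]
    exact this.symm

theorem mem_D_of_typeOf_eq {M N : Theory.ModelType.{u, v, 0} T} {a : ℕ → M} {b : ℕ → N}
    (ha : Function.Surjective a) (hb : Function.Surjective b) (h : T.typeOf a = T.typeOf b)
    (hD : a ∈ Φ.D M) : b ∈ Φ.D N := by
  obtain ⟨e, he⟩ := exists_equiv ha hb h
  have key : ∀ (k : ℕ) (y : M),
      (Φ k).Realize (Sum.elim (fun i : Fin k => b i) fun _ => e y) ↔
        (Φ k).Realize (Sum.elim (fun i : Fin k => a i) fun _ => y) := by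
    intro k y
    rw [← StrongHomClass.realize_formula e (Φ k)]
    have : (Sum.elim (fun i : Fin k => b i) fun _ => e y) =
        e ∘ (Sum.elim (fun i : Fin k => a i) fun _ : Unit => y) := by
      funext i; rcases i with i | i <;> simp [he]
    rw [this]
  intro k y hy
  obtain ⟨y, rfl⟩ := e.surjective y
  have := (key k (a k)).2 (hD k y ((key k y).1 hy))
  rwa [he] at this

theorem pairType_left {M N : Theory.ModelType.{u, v, 0} T} {a b : ℕ → M} {a' b' : ℕ → N}
    (h : pairType T M a b = pairType T N a' b') : T.typeOf a = T.typeOf a' := by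
  simpa using typeOf_comp h Sum.inl

theorem pairType_right {M N : Theory.ModelType.{u, v, 0} T} {a b : ℕ → M} {a' b' : ℕ → N}
    (h : pairType T M a b = pairType T N a' b') : T.typeOf b = T.typeOf b' := by
  simpa using typeOf_comp h Sum.inr

theorem pairType_swap {M N : Theory.ModelType.{u, v, 0} T} {a b : ℕ → M} {a' b' : ℕ → N}
    (h : pairType T M a b = pairType T N a' b') : pairType T M b a = pairType T N b' a' := by
  have := typeOf_comp h Sum.swap
  simpa [pairType] using this

theorem pairType_equiv {M N : Theory.ModelType.{u, v, 0} T} (e : M ≃[L] N) (a b : ℕ → M) :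
    pairType T N (e ∘ a) (e ∘ b) = pairType T M a b := by
  have := typeOf_equiv e (Sum.elim a b)
  rwa [Sum.comp_elim] at this

/-- An isomorphism that matches two enumerations also matches any further sequence, provided that
the joint types agree. -/
theorem equiv_apply_of_pairType {M N : Theory.ModelType.{u, v, 0} T} {a c : ℕ → M}
    {a' c' : ℕ → N} (ha : Function.Surjective a) (e : M ≃[L] N) (he : ∀ i, e (a i) = a' i)
    (h : pairType T M a c = pairType T N a' c') (i : ℕ) : e (c i) = c' i := by
  obtain ⟨j, hj⟩ := ha (c i)
  have := (typeOf_eq_iff.1 h ((Term.var (Sum.inl j)).equal (Term.var (Sum.inr i)))).1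
    (by simpa [Formula.realize_equal] using hj)
  rw [← hj, he]
  simpa [Formula.realize_equal] using this

/-- A representation of the second factor can be moved to the model of the first one. -/
theorem move {M N : Theory.ModelType.{u, v, 0} T} {b : ℕ → M} {b' c' : ℕ → N}
    (hb : Function.Surjective b) (hb' : Function.Surjective b') (hc' : Function.Surjective c')
    (h : T.typeOf b = T.typeOf b') :
    ∃ c : ℕ → M, Function.Surjective c ∧ pairType T M b c = pairType T N b' c' := by
  obtain ⟨e, he⟩ := exists_equiv hb' hb h.symm
  refine ⟨e ∘ c', e.surjective.comp hc', ?_⟩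
  rw [← pairType_equiv e b' c', show e ∘ b' = b from funext he]

theorem exists_rep (g : GPhi T Φ) : ∃ (M : Theory.ModelType.{u, v, 0} T) (a b : ℕ → M),
    Function.Surjective a ∧ Function.Surjective b ∧ a ∈ Φ.D M ∧ b ∈ Φ.D M ∧
      (g : T.CompleteType (ℕ ⊕ ℕ)) = pairType T M a b := g.2

theorem mem_D_left (g : GPhi T Φ) {M : Theory.ModelType.{u, v, 0} T} {a b : ℕ → M}
    (ha : Function.Surjective a) (h : (g : T.CompleteType (ℕ ⊕ ℕ)) = pairType T M a b) :
    a ∈ Φ.D M := by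
  obtain ⟨N, a', b', ha', -, hD, -, h'⟩ := exists_rep g
  exact mem_D_of_typeOf_eq ha' ha (pairType_left (h'.symm.trans h)) hD

theorem mem_D_right (g : GPhi T Φ) {M : Theory.ModelType.{u, v, 0} T} {a b : ℕ → M}
    (hb : Function.Surjective b) (h : (g : T.CompleteType (ℕ ⊕ ℕ)) = pairType T M a b) :
    b ∈ Φ.D M := by
  obtain ⟨N, a', b', -, hb', -, hD, h'⟩ := exists_rep g
  exact mem_D_of_typeOf_eq hb' hb (pairType_right (h'.symm.trans h)) hD

/-- The composition `tp(a, b) tp(b', c')` is defined if and only if `tp(b) = tp(b')`. -/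
theorem exists_isComp_iff (g h : GPhi T Φ) {M N : Theory.ModelType.{u, v, 0} T} {a b : ℕ → M}
    {b' c' : ℕ → N} (ha : Function.Surjective a) (hb : Function.Surjective b)
    (hb' : Function.Surjective b') (hc' : Function.Surjective c')
    (hg : (g : T.CompleteType (ℕ ⊕ ℕ)) = pairType T M a b)
    (hh : (h : T.CompleteType (ℕ ⊕ ℕ)) = pairType T N b' c') :
    (∃ k, IsComp g h k) ↔ T.typeOf b = T.typeOf b' := by
  constructor
  · rintro ⟨k, P, x, y, z, -, -, -, h1, h2, -⟩
    exact (pairType_right (hg.symm.trans h1)).trans (pairType_left (h2.symm.trans hh))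
  · intro he
    obtain ⟨c, hc, hc2⟩ := move hb hb' hc' he
    exact ⟨⟨pairType T M a c, M, a, c, ha, hc, mem_D_left g ha hg,
      mem_D_right h hc (hh.trans hc2.symm), rfl⟩, M, a, b, c, ha, hb, hc, hg,
      hh.trans hc2.symm, rfl⟩

theorem IsComp.rep {g h k : GPhi T Φ} (H : IsComp g h k) {M : Theory.ModelType.{u, v, 0} T}
    {a b c : ℕ → M} (hb : Function.Surjective b)
    (hg : (g : T.CompleteType (ℕ ⊕ ℕ)) = pairType T M a b)
    (hh : (h : T.CompleteType (ℕ ⊕ ℕ)) = pairType T M b c) :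
    (k : T.CompleteType (ℕ ⊕ ℕ)) = pairType T M a c := by
  obtain ⟨N, x, y, z, hx, hy, hz, h1, h2, h3⟩ := H
  obtain ⟨e, he⟩ := exists_equiv hy hb (pairType_right (h1.symm.trans hg))
  have hxa := equiv_apply_of_pairType hy e he (pairType_swap (h1.symm.trans hg))
  have hzc := equiv_apply_of_pairType hy e he (h2.symm.trans hh)
  rw [h3, ← pairType_equiv e x z, show e ∘ x = a from funext hxa, show e ∘ z = c from funext hzc]

theorem IsComp.unique {g h k k' : GPhi T Φ} (H : IsComp g h k) (H' : IsComp g h k') : k = k' := by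
  obtain ⟨N, x, y, z, hx, hy, hz, h1, h2, h3⟩ := H'
  exact Subtype.ext ((H.rep hy h1 h2).trans h3.symm)

theorem exists_isInv (g : GPhi T Φ) : ∃ k, IsInv g k := by
  obtain ⟨M, a, b, ha, hb, hDa, hDb, h⟩ := exists_rep g
  exact ⟨⟨pairType T M b a, M, b, a, hb, ha, hDb, hDa, rfl⟩, M, a, b, ha, hb, h, rfl⟩

open Classical in
/-- The composition `tp(a, b) tp(b, c) = tp(a, c)`. -/
noncomputable def comp (g h : GPhi T Φ) : Option (GPhi T Φ) :=
  if H : ∃ k, IsComp g h k then some H.choose else none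

/-- The inversion `tp(a, b)⁻¹ = tp(b, a)`. -/
noncomputable def inv (g : GPhi T Φ) : GPhi T Φ :=
  (exists_isInv g).choose

theorem comp_eq_some_iff {g h k : GPhi T Φ} : comp g h = some k ↔ IsComp g h k := by
  unfold comp
  split_ifs with H
  · constructor
    · intro h'
      rw [← Option.some.inj h']
      exact H.choose_spec
    · intro h'
      rw [H.choose_spec.unique h']
  · simp only [false_iff]
    exact fun h' => H ⟨k, h'⟩

theorem inv_rep (g : GPhi T Φ) {M : Theory.ModelType.{u, v, 0} T} {a b : ℕ → M}
    (hg : (g : T.CompleteType (ℕ ⊕ ℕ)) = pairType T M a b) :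
    (inv g : T.CompleteType (ℕ ⊕ ℕ)) = pairType T M b a := by
  obtain ⟨N, x, y, -, -, h1, h2⟩ := (exists_isInv g).choose_spec
  exact h2.trans (pairType_swap (h1.symm.trans hg))

theorem comp_assoc (f g h : GPhi T Φ) :
    ((comp f g).bind fun k => comp k h) = ((comp g h).bind fun k => comp f k) := by
  ext k
  simp only [Option.bind_eq_some_iff, comp_eq_some_iff]
  constructor
  · rintro ⟨l, ⟨M, a, b, c, ha, hb, hc, h1, h2, h3⟩, H⟩
    obtain ⟨N, x, y, z, hx, hy, hz, h4, h5, h6⟩ := H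
    obtain ⟨d, hd, hd2⟩ := move hc hy hz (pairType_right (h3.symm.trans h4))
    have hh := h5.trans hd2.symm
    have hk := IsComp.rep ⟨N, x, y, z, hx, hy, hz, h4, h5, h6⟩ hc h3 hh
    exact ⟨⟨pairType T M b d, M, b, d, hb, hd, mem_D_left g hb h2, mem_D_right h hd hh, rfl⟩,
      ⟨M, b, c, d, hb, hc, hd, h2, hh, rfl⟩, M, a, b, d, ha, hb, hd, h1, rfl, hk⟩
  · rintro ⟨l, ⟨M, b, c, d, hb, hc, hd, h1, h2, h3⟩, H⟩
    obtain ⟨N, x, y, z, hx, hy, hz, h4, h5, h6⟩ := H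
    obtain ⟨a, ha, ha2⟩ := move hb hy hx (pairType_left (h3.symm.trans h5))
    have hf := h4.trans (pairType_swap ha2).symm
    have hk := IsComp.rep ⟨N, x, y, z, hx, hy, hz, h4, h5, h6⟩ hb hf h3
    exact ⟨⟨pairType T M a c, M, a, c, ha, hc, mem_D_left f ha hf, mem_D_right g hc h1, rfl⟩,
      ⟨M, a, b, c, ha, hb, hc, hf, h1, rfl⟩, M, a, c, d, ha, hc, hd, rfl, h2, hk⟩

noncomputable instance : AlgGroupoid (GPhi T Φ) where
  comp := comp
  inv := inv
  assoc := comp_assoc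
  inv_comp_isSome g := by
    obtain ⟨M, a, b, ha, hb, hDa, hDb, h⟩ := exists_rep g
    rw [Option.isSome_iff_exists]
    exact ⟨⟨pairType T M b b, M, b, b, hb, hb, hDb, hDb, rfl⟩,
      comp_eq_some_iff.2 ⟨M, b, a, b, hb, ha, hb, inv_rep g h, h, rfl⟩⟩
  comp_inv_isSome g := by
    obtain ⟨M, a, b, ha, hb, hDa, hDb, h⟩ := exists_rep g
    rw [Option.isSome_iff_exists]
    exact ⟨⟨pairType T M a a, M, a, a, ha, ha, hDa, hDa, rfl⟩,
      comp_eq_some_iff.2 ⟨M, a, b, a, ha, hb, ha, h, inv_rep g h, rfl⟩⟩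
  comp_comp_inv f g k H := by
    obtain ⟨M, a, b, c, ha, hb, hc, h1, h2, h3⟩ := comp_eq_some_iff.1 H
    exact comp_eq_some_iff.2 ⟨M, a, c, b, ha, hc, hb, h3, inv_rep g h2, h1⟩
  inv_comp_comp f g k H := by
    obtain ⟨M, a, b, c, ha, hb, hc, h1, h2, h3⟩ := comp_eq_some_iff.1 H
    exact comp_eq_some_iff.2 ⟨M, b, a, c, hb, ha, hc, inv_rep f h1, h3, h2⟩

/-- The set of members of `G_Φ(T)` that contain a given formula. -/
def box (φ : L.Formula (ℕ ⊕ ℕ)) : Set (GPhi T Φ) :=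
  {g | Formula.equivSentence φ ∈ (g : T.CompleteType (ℕ ⊕ ℕ))}

theorem mem_box {φ : L.Formula (ℕ ⊕ ℕ)} {g : GPhi T Φ} {M : Theory.ModelType.{u, v, 0} T}
    {a b : ℕ → M} (hg : (g : T.CompleteType (ℕ ⊕ ℕ)) = pairType T M a b) :
    g ∈ box φ ↔ φ.Realize (Sum.elim a b) := by
  change Formula.equivSentence φ ∈ (g : T.CompleteType (ℕ ⊕ ℕ)) ↔ _
  rw [hg, pairType, Theory.CompleteType.formula_mem_typeOf]

theorem isOpen_box (φ : L.Formula (ℕ ⊕ ℕ)) : IsOpen (box φ : Set (GPhi T Φ)) :=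
  (CompleteType.isOpen_typesWith (T := T) (Formula.equivSentence φ)).preimage
    continuous_subtype_val

theorem continuous_of_box {X : Type*} [TopologicalSpace X] {f : X → GPhi T Φ}
    (h : ∀ φ : L.Formula (ℕ ⊕ ℕ), IsOpen (f ⁻¹' box φ)) : Continuous f := by
  refine Continuous.subtype_mk (f := fun x => (f x : T.CompleteType (ℕ ⊕ ℕ))) ?_
    fun x => (f x).2
  refine continuous_generateFrom_iff.2 ?_
  rintro _ ⟨ψ, rfl⟩
  have := h (Formula.equivSentence.symm ψ)
  rw [box, Equiv.apply_symm_apply] at this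
  exact this

theorem isOpen_preimage_comp (φ : L.Formula (ℕ ⊕ ℕ)) :
    IsOpen ((fun p : {p : GPhi T Φ × GPhi T Φ // (comp p.1 p.2).isSome} =>
      (comp p.1.1 p.1.2).get p.2) ⁻¹' box φ) := by
  classical
  rw [isOpen_iff_forall_mem_open]
  rintro ⟨⟨g, h⟩, hp⟩ hx
  obtain ⟨k, hk⟩ := Option.isSome_iff_exists.1 hp
  have hx' : k ∈ (box φ : Set (GPhi T Φ)) := by
    have : (comp g h).get hp = k := by simp [hk]
    rw [← this]; exact hx
  obtain ⟨M, a, b, c, ha, hb, hc, h1, h2, h3⟩ := comp_eq_some_iff.1 hk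
  rw [mem_box h3] at hx'
  choose s hs using fun j => hb (c j)
  let F : Finset (ℕ ⊕ ℕ) := φ.freeVarFinset
  let ψ : L.Formula (ℕ ⊕ ℕ) := φ.relabel (Sum.elim Sum.inl fun j => Sum.inr (s j))
  let J : Finset ℕ := F.toRight
  let χ : ℕ → L.Formula (ℕ ⊕ ℕ) := fun j =>
    (Term.var (Sum.inl (s j))).equal (Term.var (Sum.inr j))
  refine ⟨{p | p.1.1 ∈ (box ψ : Set (GPhi T Φ)) ∧ ∀ j ∈ J, p.1.2 ∈ (box (χ j) : Set (GPhi T Φ))},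
    ?_, ?_, ?_, ?_⟩
  · rintro ⟨⟨g', h'⟩, hp'⟩ ⟨hg', hh'⟩
    obtain ⟨k', hk'⟩ := Option.isSome_iff_exists.1 hp'
    obtain ⟨N, x, y, z, hx, hy, hz, e1, e2, e3⟩ := comp_eq_some_iff.1 hk'
    change (comp g' h').get hp' ∈ (box φ : Set (GPhi T Φ))
    have : (comp g' h').get hp' = k' := by simp [hk']
    rw [this, mem_box e3]
    have hg'' := (mem_box e1).1 hg'
    have hh'' : ∀ j ∈ J, y (s j) = z j := fun j hj => by
      simpa [χ, Formula.realize_equal] using (mem_box e2).1 (hh' j hj)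
    simp only [ψ, Formula.realize_relabel] at hg''
    have key : ∀ i ∈ F, (Sum.elim x y ∘ Sum.elim Sum.inl fun j => Sum.inr (s j)) i
        = Sum.elim x z i := by
      rintro (i | i) hi
      · rfl
      · exact hh'' i (by simpa [J] using hi)
    have r1 := BoundedFormula.realize_restrictFreeVar' (φ := φ) (s := (F : Set (ℕ ⊕ ℕ)))
      (subset_refl _) (v := Sum.elim x y ∘ Sum.elim Sum.inl fun j => Sum.inr (s j))
      (xs := default)
    have r2 := BoundedFormula.realize_restrictFreeVar' (φ := φ) (s := (F : Set (ℕ ⊕ ℕ)))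
      (subset_refl _) (v := Sum.elim x z) (xs := default)
    have r3 : ((Sum.elim x y ∘ Sum.elim Sum.inl fun j => Sum.inr (s j)) ∘
        (Subtype.val : ↥(F : Set (ℕ ⊕ ℕ)) → ℕ ⊕ ℕ)) = Sum.elim x z ∘ Subtype.val :=
      funext fun i => key i.1 i.2
    rw [r3] at r1
    exact r2.1 (r1.2 hg'')
  · have o1 : IsOpen {p : {p : GPhi T Φ × GPhi T Φ // (comp p.1 p.2).isSome} |
        p.1.1 ∈ (box ψ : Set (GPhi T Φ))} :=
      (isOpen_box ψ).preimage (continuous_fst.comp continuous_subtype_val)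
    have o2 : IsOpen (⋂ j ∈ J, {p : {p : GPhi T Φ × GPhi T Φ // (comp p.1 p.2).isSome} |
        p.1.2 ∈ (box (χ j) : Set (GPhi T Φ))}) :=
      isOpen_biInter_finset fun j _ =>
        (isOpen_box (χ j)).preimage (continuous_snd.comp continuous_subtype_val)
    convert o1.inter o2 using 1
    ext p
    simp
  · rw [mem_box h1, Formula.realize_relabel]
    convert hx' using 1
    funext i
    rcases i with i | i
    · rfl
    · exact hs i
  · intro j _
    rw [mem_box h2]
    simpa [χ, Formula.realize_equal] using hs j

instance : IsTopologicalGroupoid (GPhi T Φ) where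
  t2 := inferInstance
  continuous_inv := by
    refine continuous_of_box fun φ => ?_
    have : (AlgGroupoid.inv ⁻¹' box φ : Set (GPhi T Φ)) = box (φ.relabel Sum.swap) := by
      ext g
      obtain ⟨M, a, b, -, -, -, -, h⟩ := exists_rep g
      rw [mem_box h, Formula.realize_relabel, Set.mem_preimage]
      change inv g ∈ (box φ : Set (GPhi T Φ)) ↔ _
      rw [mem_box (inv_rep g h)]
      have : Sum.elim a b ∘ Sum.swap = Sum.elim b a := by
        funext i; rcases i with i | i <;> rfl
      rw [this]
    rw [this]
    exact isOpen_box _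
  continuous_comp := continuous_of_box isOpen_preimage_comp

end GPhi

/-! ### Bi-interpretations -/

/-- A (parameter-free) interpretation scheme of `L'`-structures in `L`-structures: a dimension, a
formula for the domain, one for equality, and one for each symbol of `L'`. A formula that takes
`k` elements of the interpreted structure has its variables indexed by `Fin k × Fin dim`. -/
structure InterpScheme (L : FirstOrder.Language.{u, v}) (L' : FirstOrder.Language.{u', v'}) where
  dim : ℕ
  dom : L.Formula (Fin dim)
  eqv : L.Formula (Fin 2 × Fin dim)
  func : ∀ {k : ℕ}, L'.Functions k → L.Formula (Fin (k + 1) × Fin dim)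
  rel : ∀ {k : ℕ}, L'.Relations k → L.Formula (Fin k × Fin dim)

namespace InterpScheme

variable {L : FirstOrder.Language.{u, v}} {L' : FirstOrder.Language.{u', v'}}

/-- The tuples of `M` that satisfy the domain formula. -/
abbrev Domain (Γ : InterpScheme L L') (M : Type*) [L.Structure M] : Type _ :=
  {x : Fin Γ.dim → M // Γ.dom.Realize x}

/-- `f` is a coordinate map of an interpretation of the structure `N` in `M` by the scheme `Γ`:
it is a surjection from the domain onto `N` that identifies `N`, with its structure, with the
quotient of the domain by the equality formula, on which the symbols are given by the formulas
of `Γ`. -/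
structure IsCoordinateMap (Γ : InterpScheme L L') {M N : Type*} [L.Structure M]
    [L'.Structure N] (f : Γ.Domain M → N) : Prop where
  surjective : Function.Surjective f
  eq_iff : ∀ x : Fin 2 → Γ.Domain M,
    f (x 0) = f (x 1) ↔ Γ.eqv.Realize fun p => (x p.1).1 p.2
  func_iff : ∀ {k : ℕ} (F : L'.Functions k) (x : Fin (k + 1) → Γ.Domain M),
    Structure.funMap F (fun i : Fin k => f (x i.castSucc)) = f (x (Fin.last k)) ↔
      (Γ.func F).Realize fun p => (x p.1).1 p.2
  rel_iff : ∀ {k : ℕ} (R : L'.Relations k) (x : Fin k → Γ.Domain M),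
    Structure.RelMap R (fun i => f (x i)) ↔ (Γ.rel R).Realize fun p => (x p.1).1 p.2

/-- `Γ` is an interpretation of `T'` in `T`: in each model of `T` it interprets a model of `T'`
(which is unique up to isomorphism). -/
def Interprets (Γ : InterpScheme L L') (T : L.Theory) (T' : L'.Theory) : Prop :=
  ∀ M : Theory.ModelType.{u, v, 0} T, ∃ (N : Theory.ModelType.{u', v', 0} T')
    (f : Γ.Domain M → N), Γ.IsCoordinateMap f

/-- The models `M` of `T` are uniformly definably isomorphic to the copies `M'` obtained by
interpreting `N` in `M` by `Γ`, and then `M'` in `N` by `Δ`: one formula `θ(x, y)` of `L` defines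
in all models of `T` the graph of an isomorphism from `M` to `M'`, where the elements of `M'` are
represented by tuples `y` in `M` through the two coordinate maps. -/
def DefinablyIsoToComposite (T : L.Theory) (Γ : InterpScheme L L') (Δ : InterpScheme L' L) :
    Prop :=
  ∃ θ : L.Formula (Unit ⊕ Fin Δ.dim × Fin Γ.dim),
    ∀ (M : Theory.ModelType.{u, v, 0} T) (N M' : Type) [L'.Structure N] [L.Structure M']
      (f : Γ.Domain M → N) (g : Δ.Domain N → M'),
      Γ.IsCoordinateMap f → Δ.IsCoordinateMap g →
        ∃ i : M ≃[L] M', ∀ (x : M) (y : Fin Δ.dim → Fin Γ.dim → M),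
          θ.Realize (Sum.elim (fun _ => x) fun p => y p.1 p.2) ↔
            ∃ (hy : ∀ j, Γ.dom.Realize (y j)) (hz : Δ.dom.Realize fun j => f ⟨y j, hy j⟩),
              i x = g ⟨fun j => f ⟨y j, hy j⟩, hz⟩

end InterpScheme

/-- `T` and `T'` are bi-interpretable: each is interpreted in the other, such that the models of
`T` and of `T'` are uniformly definably isomorphic to their copies interpreted in themselves by
the two composites. -/
def BiInterpretable {L : FirstOrder.Language.{u, v}} {L' : FirstOrder.Language.{u', v'}} (T : L.Theory)
    (T' : L'.Theory) : Prop :=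
  ∃ (Γ : InterpScheme L L') (Δ : InterpScheme L' L),
    Γ.Interprets T T' ∧ Δ.Interprets T' T ∧
      InterpScheme.DefinablyIsoToComposite T Γ Δ ∧ InterpScheme.DefinablyIsoToComposite T' Δ Γ

/-!
The isomorphism is given by matching positions in sequences.

Assume first that `T = T'`. For rich sequences `Φ` and `Ψ`, a back-and-forth produces maps
`s, t : ℕ → ℕ` such that, in every model, `a ↦ a ∘ s` is a bijection from `D_Φ` to `D_Ψ` with
inverse `b ↦ b ∘ t`. A finite stage is a coordinate map from the sequences of length `n` that
satisfy the first `n` conditions of `Φ` onto those of length `m` that satisfy the first `m`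
conditions of `Ψ`. Its fibres are definable and non-empty, so by richness of `Ψ` there are further
positions at which any sequence in `D_Ψ` lists a point of its fibre, and at which all points of the
fibre can be listed (`FormulaSeq.IsRich.exists_positions`): this is a coordinate map in the other
direction, a section of the given one up to restriction. One continues alternately
(`UniformInterp.IsApprox.step`) and passes to the limit (`UniformInterp.exists_correspond`). Then
`tp(a, b) ↦ tp(a ∘ s, b ∘ s)` is the isomorphism; it is continuous because a formula about the image
is a formula about `(a, b)`.

For bi-interpretable theories the same argument applies to pairs of a model `M` of `T` and a model
`N` of `T'` that are interpreted in each other: the entry of a sequence in `N` is now coded by a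
tuple of entries of a sequence in `M`, and conversely. What is needed is that definable relations of
one structure have definable preimages in the other one
(`UniformInterp.HasDefinablePreimage.of_uniformlyDefinable`) and that the composites of the two
codings are definable in both structures, uniformly over a class of pairs in which all models
occur (`BiInterpretable.exists_uniformInterp`). A bi-interpretation provides the two isomorphisms
with the copies independently of each other. The first one can be made the identity by a change of
the coordinate maps; the second one is then an automorphism of `N`, which is eliminated with the help
of definability of the first composite (`UniformInterp.CompositeDefinable.of_twisted`).
As an enumeration in `D_Ψ(N)` contains everything definable from its entries, enumerations of `M`
correspond to enumerations of `N` (`UniformInterp.Correspond.surjective`). The statement about one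
theory is the case of the trivial bi-interpretation (`BiInterpretable.refl`).
-/

/-! ### Uniformly definable families of relations -/

section Definability

variable {L : FirstOrder.Language.{u, v}} {T : L.Theory} {I : Type*}
  {M : I → Theory.ModelType.{u, v, 0} T} {α β : Type*}

/-- A family of relations `S i` on the models `M i` is uniformly definable if one formula,
without parameters, defines all of them. -/
def UniformlyDefinable (M : I → Theory.ModelType.{u, v, 0} T) (S : ∀ i, (α → M i) → Prop) : Prop :=
  ∃ φ : L.Formula α, ∀ i v, φ.Realize v ↔ S i v

namespace UniformlyDefinable

theorem congr {S S' : ∀ i, (α → M i) → Prop} (h : UniformlyDefinable M S)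
    (e : ∀ i v, S i v ↔ S' i v) : UniformlyDefinable M S' := by
  obtain ⟨φ, hφ⟩ := h
  exact ⟨φ, fun i v => (hφ i v).trans (e i v)⟩

theorem and {S S' : ∀ i, (α → M i) → Prop} (h : UniformlyDefinable M S)
    (h' : UniformlyDefinable M S') : UniformlyDefinable M fun i v => S i v ∧ S' i v := by
  obtain ⟨φ, hφ⟩ := h
  obtain ⟨ψ, hψ⟩ := h'
  exact ⟨φ ⊓ ψ, fun i v => by rw [Formula.realize_inf, hφ, hψ]⟩

theorem forall_index [Finite β] {S : ∀ i, β → (α → M i) → Prop}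
    (h : ∀ b, UniformlyDefinable M fun i v => S i b v) :
    UniformlyDefinable M fun i v => ∀ b, S i b v := by
  choose φ hφ using h
  exact ⟨Formula.iInf φ, fun i v => by simp only [Formula.realize_iInf, hφ]⟩

theorem relabel {S : ∀ i, (α → M i) → Prop} (h : UniformlyDefinable M S) (g : α → β) :
    UniformlyDefinable M fun i v => S i fun z => v (g z) := by
  obtain ⟨φ, hφ⟩ := h
  exact ⟨φ.relabel g, fun i v => by rw [Formula.realize_relabel, hφ]; rfl⟩

theorem exists_tuple [Finite β] {S : ∀ i, (α → M i) → (β → M i) → Prop}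
    (h : UniformlyDefinable M fun i (v : α ⊕ β → M i) =>
      S i (fun z => v (Sum.inl z)) fun z => v (Sum.inr z)) :
    UniformlyDefinable M fun i v => ∃ w, S i v w := by
  obtain ⟨φ, hφ⟩ := h
  refine ⟨φ.iExs β, fun i v => ?_⟩
  rw [Formula.realize_iExs]
  exact exists_congr fun w => hφ i _

/-- Uniformly definable relations are invariant under automorphisms. -/
theorem invariant {S : ∀ i, (α → M i) → Prop} (h : UniformlyDefinable M S) {i : I}
    (e : M i ≃[L] M i) (v : α → M i) : S i (fun z => e (v z)) ↔ S i v := by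
  obtain ⟨φ, hφ⟩ := h
  rw [← hφ, ← hφ]
  exact StrongHomClass.realize_formula e φ

end UniformlyDefinable

end Definability

/-! ### Transfer of definability along an interpretation -/

/-- A family of interpretations, by one scheme, of the models `N i` of `T'` in the models `M i`
of `T`. -/
structure UniformInterp {L : FirstOrder.Language.{u, v}} {L' : FirstOrder.Language.{u', v'}}
    {T : L.Theory} {T' : L'.Theory} {I : Type*} (M : I → Theory.ModelType.{u, v, 0} T)
    (N : I → Theory.ModelType.{u', v', 0} T') where
  scheme : InterpScheme L L'
  map : ∀ i, scheme.Domain (M i) → N i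
  isCoordinateMap : ∀ i, scheme.IsCoordinateMap (map i)

namespace UniformInterp

variable {L : FirstOrder.Language.{u, v}} {L' : FirstOrder.Language.{u', v'}}
  {T : L.Theory} {T' : L'.Theory} {I : Type*} {M : I → Theory.ModelType.{u, v, 0} T}
  {N : I → Theory.ModelType.{u', v', 0} T'} (C : UniformInterp M N) {α β : Type*}

/-- The dimension of the underlying scheme. -/
abbrev dim : ℕ := C.scheme.dim

/-- The tuple `y` of `M i` belongs to the domain of the interpretation and represents the
element `x` of `N i`. -/
def Codes (i : I) (y : Fin C.dim → M i) (x : N i) : Prop :=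
  ∃ h : C.scheme.dom.Realize y, C.map i ⟨y, h⟩ = x

variable {C}

theorem Codes.unique {i : I} {y : Fin C.dim → M i} {x x' : N i} (h : C.Codes i y x)
    (h' : C.Codes i y x') : x = x' := by
  obtain ⟨_, rfl⟩ := h
  obtain ⟨_, rfl⟩ := h'
  rfl

variable (C)

theorem exists_codes (i : I) (x : N i) : ∃ y, C.Codes i y x := by
  obtain ⟨⟨y, h⟩, hy⟩ := (C.isCoordinateMap i).surjective x
  exact ⟨y, h, hy⟩

theorem realize_dom_iff {i : I} {y : Fin C.dim → M i} :
    C.scheme.dom.Realize y ↔ ∃ x, C.Codes i y x :=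
  ⟨fun h => ⟨_, h, rfl⟩, fun ⟨_, h, _⟩ => h⟩

/-- The preimage in the `M i` of a family `S` of relations on the `N i` is uniformly definable.
The tuples of variables may be infinite, so that only the restriction to tuples of codes is
considered. -/
def HasDefinablePreimage (S : ∀ i, (α → N i) → Prop) : Prop :=
  ∃ ψ : L.Formula (α × Fin C.dim), ∀ i (v : α × Fin C.dim → M i) (b : α → N i),
    (∀ z, C.Codes i (fun t => v (z, t)) (b z)) → (ψ.Realize v ↔ S i b)

variable {C}

namespace HasDefinablePreimage

theorem congr {S S' : ∀ i, (α → N i) → Prop} (h : C.HasDefinablePreimage S)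
    (e : ∀ i v, S i v ↔ S' i v) : C.HasDefinablePreimage S' := by
  obtain ⟨φ, hφ⟩ := h
  exact ⟨φ, fun i v b hb => (hφ i v b hb).trans (e i b)⟩

theorem falsum : C.HasDefinablePreimage fun i (_ : α → N i) => False :=
  ⟨⊥, fun _ _ _ _ => Iff.rfl⟩

theorem imp {S S' : ∀ i, (α → N i) → Prop} (h : C.HasDefinablePreimage S)
    (h' : C.HasDefinablePreimage S') : C.HasDefinablePreimage fun i v => S i v → S' i v := by
  obtain ⟨φ, hφ⟩ := h
  obtain ⟨ψ, hψ⟩ := h'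
  exact ⟨φ.imp ψ, fun i v b hb => by rw [Formula.realize_imp, hφ i v b hb, hψ i v b hb]⟩

theorem and {S S' : ∀ i, (α → N i) → Prop} (h : C.HasDefinablePreimage S)
    (h' : C.HasDefinablePreimage S') : C.HasDefinablePreimage fun i v => S i v ∧ S' i v := by
  obtain ⟨φ, hφ⟩ := h
  obtain ⟨ψ, hψ⟩ := h'
  exact ⟨φ ⊓ ψ, fun i v b hb => by rw [Formula.realize_inf, hφ i v b hb, hψ i v b hb]⟩

theorem forall_index [Finite β] {S : ∀ i, β → (α → N i) → Prop}
    (h : ∀ b, C.HasDefinablePreimage fun i v => S i b v) :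
    C.HasDefinablePreimage fun i v => ∀ b, S i b v := by
  choose φ hφ using h
  exact ⟨Formula.iInf φ, fun i v b hb => by
    rw [Formula.realize_iInf]
    exact forall_congr' fun c => hφ c i v b hb⟩

theorem relabel {S : ∀ i, (α → N i) → Prop} (h : C.HasDefinablePreimage S) (g : α → β) :
    C.HasDefinablePreimage fun i v => S i fun z => v (g z) := by
  obtain ⟨φ, hφ⟩ := h
  refine ⟨φ.relabel (Prod.map g id), fun i v b hb => ?_⟩
  rw [Formula.realize_relabel]
  exact hφ i _ _ fun z => hb (g z)

theorem exists_tuple [Finite β] {S : ∀ i, (α → N i) → (β → N i) → Prop}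
    (h : C.HasDefinablePreimage fun i (v : α ⊕ β → N i) =>
      S i (fun z => v (Sum.inl z)) fun z => v (Sum.inr z)) :
    C.HasDefinablePreimage fun i v => ∃ w, S i v w := by
  obtain ⟨φ, hφ⟩ := h
  refine ⟨Formula.iExs (β × Fin C.dim)
    (Formula.iInf (fun b : β => C.scheme.dom.relabel fun t => Sum.inr (b, t)) ⊓
      φ.relabel fun z => z.1.elim (fun a => Sum.inl (a, z.2)) fun b => Sum.inr (b, z.2)),
    fun i v b hb => ?_⟩
  rw [Formula.realize_iExs]
  simp only [Formula.realize_inf, Formula.realize_iInf, Formula.realize_relabel]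
  constructor
  · rintro ⟨y, h1, h2⟩
    choose w hw using fun b => C.realize_dom_iff.1 (h1 b)
    refine ⟨w, (hφ i _ (Sum.elim b w) ?_).1 h2⟩
    rintro (z | z)
    · exact hb z
    · exact hw z
  · rintro ⟨w, hw⟩
    choose y hy using fun z => C.exists_codes i (w z)
    refine ⟨fun z => y z.1 z.2, fun z => C.realize_dom_iff.2 ⟨_, hy z⟩,
      (hφ i _ (Sum.elim b w) ?_).2 hw⟩
    rintro (z | z)
    · exact hb z
    · exact hy z

theorem forall_tuple [Finite β] {S : ∀ i, (α → N i) → (β → N i) → Prop}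
    (h : C.HasDefinablePreimage fun i (v : α ⊕ β → N i) =>
      S i (fun z => v (Sum.inl z)) fun z => v (Sum.inr z)) :
    C.HasDefinablePreimage fun i v => ∀ w, S i v w := by
  refine ((exists_tuple (S := fun i v w => S i v w → False) (h.imp falsum)).imp falsum).congr
    fun i v => ?_
  constructor
  · intro h w
    by_contra hw
    exact h ⟨w, hw⟩
  · rintro h ⟨w, hw⟩
    exact hw (h w)

theorem eq (a b : α) : C.HasDefinablePreimage fun i (v : α → N i) => v a = v b := by
  refine ⟨C.scheme.eqv.relabel fun z => (![a, b] z.1, z.2), fun i v c hc => ?_⟩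
  obtain ⟨h1, h1'⟩ := hc a
  obtain ⟨h2, h2'⟩ := hc b
  have := (C.isCoordinateMap i).eq_iff ![⟨_, h1⟩, ⟨_, h2⟩]
  simp only [Matrix.cons_val_zero, Matrix.cons_val_one, h1', h2'] at this
  refine Iff.trans ?_ this.symm
  rw [Formula.realize_relabel]
  refine iff_of_eq (congrArg _ (funext fun z => ?_))
  obtain ⟨x, t⟩ := z
  fin_cases x <;> rfl

theorem rel {k : ℕ} (R : L'.Relations k) (g : Fin k → α) :
    C.HasDefinablePreimage fun i (v : α → N i) => Structure.RelMap R fun j => v (g j) := by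
  refine ⟨(C.scheme.rel R).relabel fun z => (g z.1, z.2), fun i v c hc => ?_⟩
  choose h h' using fun j => hc (g j)
  have := (C.isCoordinateMap i).rel_iff R fun j => ⟨_, h j⟩
  simp only [h'] at this
  refine Iff.trans ?_ this.symm
  rw [Formula.realize_relabel]
  rfl

theorem func {k : ℕ} (F : L'.Functions k) (g : Fin k → α) (a : α) :
    C.HasDefinablePreimage fun i (v : α → N i) =>
      Structure.funMap F (fun j => v (g j)) = v a := by
  refine ⟨(C.scheme.func F).relabel fun z => (Fin.snoc (α := fun _ => α) g a z.1, z.2),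
    fun i v c hc => ?_⟩
  choose h h' using fun j => hc (Fin.snoc (α := fun _ => α) g a j)
  have := (C.isCoordinateMap i).func_iff F fun j => ⟨_, h j⟩
  rw [funext fun j : Fin k => h' j.castSucc, h' (Fin.last k)] at this
  simp only [Fin.snoc_castSucc, Fin.snoc_last] at this
  refine Iff.trans ?_ this.symm
  rw [Formula.realize_relabel]
  rfl

theorem term (t : L'.Term α) :
    C.HasDefinablePreimage fun i (v : α ⊕ Unit → N i) =>
      t.realize (fun z => v (Sum.inl z)) = v (Sum.inr ()) := by
  induction t with
  | var a => exact eq (Sum.inl a) (Sum.inr ())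
  | @func k F ts ih =>
    have h := exists_tuple (C := C) (α := α ⊕ Unit) (β := Fin k)
      (S := fun i v w => (∀ j, (ts j).realize (fun z => v (Sum.inl z)) = w j) ∧
        Structure.funMap F w = v (Sum.inr ()))
      ((forall_index fun j => ((ih j).relabel
        (Sum.elim (fun z => Sum.inl (Sum.inl z)) fun _ => Sum.inr j))).and
        (func F (fun j => Sum.inr j) (Sum.inl (Sum.inr ()))))
    refine h.congr fun i v => ?_
    constructor
    · rintro ⟨w, hw, h⟩
      rw [Term.realize_func, ← h]
      exact congrArg _ (funext hw)
    · intro h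
      exact ⟨_, fun _ => rfl, h⟩

theorem boundedFormula {n : ℕ} (φ : L'.BoundedFormula α n) :
    C.HasDefinablePreimage fun i (v : α ⊕ Fin n → N i) =>
      φ.Realize (fun z => v (Sum.inl z)) fun z => v (Sum.inr z) := by
  have hS : ∀ {m : ℕ} {X : Type} (v : α ⊕ Fin m → X),
      Sum.elim (fun z => v (Sum.inl z)) (fun z => v (Sum.inr z)) = v :=
    fun v => Sum.elim_comp_inl_inr v
  induction φ with
  | falsum => exact falsum
  | equal t₁ t₂ =>
    refine (exists_tuple (β := Unit)
      (S := fun i v w => t₁.realize v = w () ∧ t₂.realize v = w ())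
      ((term t₁).and (term t₂))).congr fun i v => ?_
    simp only [BoundedFormula.Realize, hS]
    exact ⟨fun ⟨w, h1, h2⟩ => h1.trans h2.symm, fun h => ⟨fun _ => _, h, rfl⟩⟩
  | @rel m k R ts =>
    refine (exists_tuple (β := Fin k)
      (S := fun i v w => (∀ j, (ts j).realize v = w j) ∧ Structure.RelMap R w)
      ((forall_index fun j => (term (ts j)).relabel
        (Sum.elim Sum.inl fun _ => Sum.inr j)).and (rel R Sum.inr))).congr fun i v => ?_
    simp only [BoundedFormula.Realize, hS]
    constructor
    · rintro ⟨w, hw, h⟩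
      rwa [funext hw]
    · exact fun h => ⟨_, fun _ => rfl, h⟩
  | imp _ _ ih₁ ih₂ => exact ih₁.imp ih₂
  | @all m φ ih =>
    refine (forall_tuple (β := Unit)
      (S := fun i v w => φ.Realize (fun z => v (Sum.inl z))
        (Fin.snoc (fun z => v (Sum.inr z)) (w ())))
      ((ih.relabel (Sum.elim (fun z => Sum.inl (Sum.inl z))
        (Fin.snoc (α := fun _ => (α ⊕ Fin m) ⊕ Unit) (fun z => Sum.inl (Sum.inr z))
          (Sum.inr ())))).congr fun i v => ?_)).congr fun i v => ?_
    · refine iff_of_eq (congrArg _ (funext fun z => ?_))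
      refine Fin.lastCases ?_ (fun z => ?_) z <;> simp
    · rw [BoundedFormula.realize_all]
      exact ⟨fun h a => h fun _ => a, fun h w => h _⟩

/-- Uniformly definable families of relations have uniformly definable preimages. -/
theorem of_uniformlyDefinable {S : ∀ i, (α → N i) → Prop} (h : UniformlyDefinable N S) :
    C.HasDefinablePreimage S := by
  obtain ⟨φ, hφ⟩ := h
  obtain ⟨ψ, hψ⟩ := boundedFormula (C := C) φ
  refine ⟨ψ.relabel (Prod.map (Sum.elim id Fin.elim0) id), fun i v b hb => ?_⟩
  rw [Formula.realize_relabel, ← hφ]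
  refine (hψ i _ (Sum.elim b Fin.elim0) ?_).trans ?_
  · rintro (z | z)
    · exact hb z
    · exact z.elim0
  · exact iff_of_eq (congrArg _ (Subsingleton.elim _ _))

/-- On finite tuples, membership in the domain of the interpretation is definable as well. -/
theorem uniformlyDefinable [Finite α] {S : ∀ i, (α → N i) → Prop}
    (h : C.HasDefinablePreimage S) :
    UniformlyDefinable M fun i (v : α × Fin C.dim → M i) =>
      ∃ b : α → N i, (∀ z, C.Codes i (fun t => v (z, t)) (b z)) ∧ S i b := by
  obtain ⟨ψ, hψ⟩ := h
  refine ⟨Formula.iInf (fun z => C.scheme.dom.relabel fun t => (z, t)) ⊓ ψ, fun i v => ?_⟩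
  simp only [Formula.realize_inf, Formula.realize_iInf, Formula.realize_relabel]
  constructor
  · rintro ⟨h1, h2⟩
    choose b hb using fun z => C.realize_dom_iff.1 (h1 z)
    exact ⟨b, hb, (hψ i v b hb).1 h2⟩
  · rintro ⟨b, hb, h⟩
    exact ⟨fun z => C.realize_dom_iff.2 ⟨_, hb z⟩, (hψ i v b hb).2 h⟩

end HasDefinablePreimage

end UniformInterp

/-! ### Bi-interpretations as pairs of uniform interpretations -/

section BiInterp

variable {L : FirstOrder.Language.{u, v}} {L' : FirstOrder.Language.{u', v'}}
  {T : L.Theory} {T' : L'.Theory} {I : Type*} {M : I → Theory.ModelType.{u, v, 0} T}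
  {N : I → Theory.ModelType.{u', v', 0} T'}

namespace UniformInterp

/-- The array `w` of elements of `N i` represents, through a tuple of `M i`, the element `x`
of `N i`. -/
def CodesTwice (C : UniformInterp M N) (C' : UniformInterp N M) (i : I)
    (w : Fin C.dim → Fin C'.dim → N i) (x : N i) : Prop :=
  ∃ y : Fin C.dim → M i, (∀ t, C'.Codes i (w t) (y t)) ∧ C.Codes i y x

theorem CodesTwice.unique {C : UniformInterp M N} {C' : UniformInterp N M} {i : I}
    {w : Fin C.dim → Fin C'.dim → N i} {x x' : N i} (h : C.CodesTwice C' i w x)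
    (h' : C.CodesTwice C' i w x') : x = x' := by
  obtain ⟨y, h1, h2⟩ := h
  obtain ⟨y', h1', h2'⟩ := h'
  obtain rfl : y = y' := funext fun t => (h1 t).unique (h1' t)
  exact h2.unique h2'

theorem exists_codesTwice (C : UniformInterp M N) (C' : UniformInterp N M) (i : I) (x : N i) :
    ∃ w, C.CodesTwice C' i w x := by
  obtain ⟨y, hy⟩ := C.exists_codes i x
  choose w hw using fun t => C'.exists_codes i (y t)
  exact ⟨w, y, hw, hy⟩

/-- The isomorphisms between the models `N i` and their copies, interpreted in themselves by the
composite of two uniform interpretations, are uniformly definable. -/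
def CompositeDefinable (C : UniformInterp M N) (C' : UniformInterp N M) : Prop :=
  UniformlyDefinable N fun i (v : Unit ⊕ Fin C.dim × Fin C'.dim → N i) =>
    C.CodesTwice C' i (fun t s => v (Sum.inr (t, s))) (v (Sum.inl ()))

/-- If one composite is definable, then the other one is definable as soon as it is definable up
to automorphisms `j i`. Indeed, let `R(x, w)` be the relation that has to be defined. Its preimage
in the `M i` is definable because the first composite is. The pullback of this preimage to `N i`
is definable, and as codes for `j i` of an element can be found definably, so is the relation
`R(j x, j w)`. But `R(j x, w)` is definable by hypothesis, hence invariant under `j`, which means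
that `R(j x, j w)` is equivalent to `R(x, w)`. -/
theorem CompositeDefinable.of_twisted {C : UniformInterp M N} {C' : UniformInterp N M}
    (h : CompositeDefinable C' C) (j : ∀ i, N i ≃[L'] N i)
    (hj : UniformlyDefinable N fun i (v : Unit ⊕ Fin C.dim × Fin C'.dim → N i) =>
      C.CodesTwice C' i (fun t s => v (Sum.inr (t, s))) (j i (v (Sum.inl ())))) :
    CompositeDefinable C C' := by
  have hcode : UniformlyDefinable M fun i (v : Fin 2 × Fin C.dim → M i) =>
      ∃ b : Fin 2 → N i, (∀ z, C.Codes i (fun t => v (z, t)) (b z)) ∧ b 0 = b 1 :=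
    (HasDefinablePreimage.eq 0 1).uniformlyDefinable
  have hdom : ∀ z : Unit ⊕ Fin C.dim × Fin C'.dim, UniformlyDefinable M
      fun i (v : (Unit ⊕ Fin C.dim × Fin C'.dim) × Fin C.dim → M i) =>
        ∃ x, C.Codes i (fun t => v (z, t)) x := fun z => by
    refine ⟨C.scheme.dom.relabel fun t => (z, t), fun i v => ?_⟩
    rw [Formula.realize_relabel]
    exact C.realize_dom_iff
  -- The preimage of the relation in the `M i`.
  have hM : UniformlyDefinable M
      fun i (v : (Unit ⊕ Fin C.dim × Fin C'.dim) × Fin C.dim → M i) =>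
        ∃ b : Unit ⊕ Fin C.dim × Fin C'.dim → N i, (∀ z, C.Codes i (fun t => v (z, t)) (b z)) ∧
          C.CodesTwice C' i (fun t s => b (Sum.inr (t, s))) (b (Sum.inl ())) := by
    refine ((UniformlyDefinable.forall_index hdom).and
      (UniformlyDefinable.exists_tuple (β := Fin C.dim)
        (S := fun i v y => (∀ t, C'.CodesTwice C i (fun s s' => v (Sum.inr (t, s), s')) (y t)) ∧
          ∃ b : Fin 2 → N i, (∀ z, C.Codes i
            (fun t => (![y t, v (Sum.inl (), t)] : Fin 2 → M i) z) (b z)) ∧ b 0 = b 1)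
        ((UniformlyDefinable.forall_index fun t => UniformlyDefinable.relabel h
          (Sum.elim (fun _ => Sum.inr t) fun s => Sum.inl (Sum.inr (t, s.1), s.2))).and
          ((hcode.relabel fun z => (![Sum.inr z.2, Sum.inl (Sum.inl (), z.2)] : Fin 2 →
            ((Unit ⊕ Fin C.dim × Fin C'.dim) × Fin C.dim) ⊕ Fin C.dim) z.1).congr
              fun i v => ?_)))).congr fun i v => ?_
    · refine exists_congr fun b => and_congr_left fun _ => forall_congr' fun z => ?_
      refine iff_of_eq (congrFun (congrArg _ (funext fun t => ?_)) _)
      fin_cases z <;> rfl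
    · constructor
      · rintro ⟨h1, y, h2, b, h3, h4⟩
        choose c hc using h1
        refine ⟨c, hc, y, fun t => ?_, ?_⟩
        · obtain ⟨w, hw, hw'⟩ := h2 t
          rwa [show w = fun s => c (Sum.inr (t, s)) from
            funext fun s => (hw s).unique (hc _)] at hw'
        · have h5 := h3 0
          have h6 := (h3 1).unique (hc (Sum.inl ()))
          rw [← h6, ← h4]
          exact h5
      · rintro ⟨b, hb, y, hy, hy'⟩
        refine ⟨fun z => ⟨_, hb z⟩, y, fun t => ⟨_, fun s => hb _, hy t⟩,
          fun _ => b (Sum.inl ()), fun z => ?_, rfl⟩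
        fin_cases z
        · exact hy'
        · exact hb _
  have hN := (HasDefinablePreimage.of_uniformlyDefinable (C := C') hM).uniformlyDefinable
  refine (UniformlyDefinable.exists_tuple
    (β := ((Unit ⊕ Fin C.dim × Fin C'.dim) × Fin C.dim) × Fin C'.dim)
    (S := fun i v V => (∀ z, C.CodesTwice C' i (fun t s => V ((z, t), s)) (j i (v z))) ∧
      ∃ a : (Unit ⊕ Fin C.dim × Fin C'.dim) × Fin C.dim → M i,
        (∀ z, C'.Codes i (fun s => V (z, s)) (a z)) ∧
        ∃ b : Unit ⊕ Fin C.dim × Fin C'.dim → N i, (∀ z, C.Codes i (fun t => a (z, t)) (b z)) ∧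
          C.CodesTwice C' i (fun t s => b (Sum.inr (t, s))) (b (Sum.inl ())))
    ((UniformlyDefinable.forall_index fun z => hj.relabel
      (Sum.elim (fun _ => Sum.inl z) fun s => Sum.inr ((z, s.1), s.2))).and
      (hN.relabel Sum.inr))).congr fun i v => ?_
  -- It remains to see that `j i` preserves the relation.
  have hR : C.CodesTwice C' i (fun t s => j i (v (Sum.inr (t, s)))) (j i (v (Sum.inl ()))) ↔
      C.CodesTwice C' i (fun t s => v (Sum.inr (t, s))) (v (Sum.inl ())) := by
    have key : ∀ (w : Fin C.dim → Fin C'.dim → N i) (x : N i),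
        C.CodesTwice C' i (fun t s => j i (w t s)) (j i (j i x)) ↔
          C.CodesTwice C' i w (j i x) := fun w x => by
      simpa using hj.invariant (j i) (Sum.elim (fun _ => x) fun s => w s.1 s.2)
    have := key (fun t s => v (Sum.inr (t, s))) ((j i).symm (v (Sum.inl ())))
    rwa [FirstOrder.Language.Equiv.apply_symm_apply] at this
  rw [← hR]
  constructor
  · rintro ⟨V, hV, a, ha, b, hb, h⟩
    have : b = fun z => j i (v z) := funext fun z =>
      CodesTwice.unique ⟨_, fun t => ha (z, t), hb z⟩ (hV z)
    rwa [this] at h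
  · intro h
    choose V hV using fun z => C.exists_codesTwice C' i (j i (v z))
    choose a ha hb using hV
    exact ⟨fun z => V z.1.1 z.1.2 z.2, fun z => ⟨a z, ha z, hb z⟩, fun z => a z.1 z.2,
      fun z => ha z.1 z.2, _, hb, h⟩

end UniformInterp

theorem InterpScheme.IsCoordinateMap.comp_equiv {Γ : InterpScheme L L'} {X Y Z : Type*}
    [L.Structure X] [L'.Structure Y] [L'.Structure Z] {f : Γ.Domain X → Y}
    (hf : Γ.IsCoordinateMap f) (e : Y ≃[L'] Z) : Γ.IsCoordinateMap fun x => e (f x) where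
  surjective := e.surjective.comp hf.surjective
  eq_iff x := by rw [← hf.eq_iff, e.injective.eq_iff]
  func_iff F x := by
    rw [← hf.func_iff, ← e.injective.eq_iff, e.map_fun]
    rfl
  rel_iff R x := by
    rw [← hf.rel_iff, ← e.map_rel]
    rfl

/-- A model `M` of `T` and a model `N` of `T'` that are interpreted in each other. -/
structure MutualInterp (T : L.Theory) (T' : L'.Theory) (Γ : InterpScheme L L')
    (Δ : InterpScheme L' L) where
  M : Theory.ModelType.{u, v, 0} T
  N : Theory.ModelType.{u', v', 0} T'
  p : Γ.Domain M → N
  q : Δ.Domain N → M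
  isCoordinateMap_p : Γ.IsCoordinateMap p
  isCoordinateMap_q : Δ.IsCoordinateMap q

/-- A bi-interpretation yields, over a family of pairs of models in which all models of `T` and of
`T'` occur, two uniform interpretations with definable composites. The members of the family are
the mutual interpretations for which the first definable isomorphism is the identity. -/
theorem BiInterpretable.exists_uniformInterp (h : BiInterpretable T T') :
    ∃ (I : Type (max u v u' v' 1)) (M : I → Theory.ModelType.{u, v, 0} T)
      (N : I → Theory.ModelType.{u', v', 0} T')
      (C : UniformInterp M N) (C' : UniformInterp N M),
      C.CompositeDefinable C' ∧ C'.CompositeDefinable C ∧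
        Function.Surjective M ∧ Function.Surjective N := by
  obtain ⟨Γ, Δ, hΓ, hΔ, ⟨θ, hθ⟩, θ', hθ'⟩ := h
  let I := {A : MutualInterp T T' Γ Δ // ∀ (x : A.M) (y : Fin Δ.dim → Fin Γ.dim → A.M),
    θ.Realize (Sum.elim (fun _ => x) fun p => y p.1 p.2) ↔
      ∃ (hy : ∀ j, Γ.dom.Realize (y j)) (hz : Δ.dom.Realize fun j => A.p ⟨y j, hy j⟩),
        x = A.q ⟨fun j => A.p ⟨y j, hy j⟩, hz⟩}
  let C : UniformInterp (fun A : I => A.1.M) fun A : I => A.1.N :=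
    ⟨Γ, fun A => A.1.p, fun A => A.1.isCoordinateMap_p⟩
  let C' : UniformInterp (fun A : I => A.1.N) fun A : I => A.1.M :=
    ⟨Δ, fun A => A.1.q, fun A => A.1.isCoordinateMap_q⟩
  -- Any mutual interpretation can be corrected by an automorphism to belong to the family.
  have hI : ∀ A : MutualInterp T T' Γ Δ, ∃ B : I, B.1.M = A.M ∧ B.1.N = A.N := by
    intro A
    obtain ⟨i, hi⟩ := hθ A.M A.N A.M A.p A.q A.isCoordinateMap_p A.isCoordinateMap_q
    refine ⟨⟨⟨A.M, A.N, A.p, fun x => i.symm (A.q x), A.isCoordinateMap_p,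
      A.isCoordinateMap_q.comp_equiv i.symm⟩, fun x y => (hi x y).trans ?_⟩, rfl, rfl⟩
    refine exists_congr fun hy => exists_congr fun hz => ?_
    refine ⟨fun h => ?_, fun h => ?_⟩
    · change x = i.symm _
      rw [← h, FirstOrder.Language.Equiv.symm_apply_apply]
    · change x = i.symm _ at h
      rw [h, FirstOrder.Language.Equiv.apply_symm_apply]
  have h1 : C'.CompositeDefinable C := by
    refine ⟨θ, fun A v => ?_⟩
    have := A.2 (v (Sum.inl ())) fun t s => v (Sum.inr (t, s))
    rw [show Sum.elim (fun _ => v (Sum.inl ())) (fun p => v (Sum.inr (p.1, p.2))) = v from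
      Sum.elim_comp_inl_inr v] at this
    refine this.trans ⟨fun ⟨hy, hz, h⟩ => ⟨_, fun t => ⟨hy t, rfl⟩, hz, h.symm⟩, ?_⟩
    rintro ⟨y, hy, hz⟩
    choose hy hy' using hy
    obtain rfl := funext hy'
    exact ⟨hy, hz.1, hz.2.symm⟩
  have h2 : ∀ A : I, ∃ j : A.1.N ≃[L'] A.1.N, ∀ v : Unit ⊕ Fin C.dim × Fin C'.dim → A.1.N,
      θ'.Realize v ↔
        C.CodesTwice C' A (fun t s => v (Sum.inr (t, s))) (j (v (Sum.inl ()))) := by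
    intro A
    obtain ⟨j, hj⟩ := hθ' A.1.N A.1.M A.1.N A.1.q A.1.p A.1.isCoordinateMap_q
      A.1.isCoordinateMap_p
    refine ⟨j, fun v => ?_⟩
    have := hj (v (Sum.inl ())) fun t s => v (Sum.inr (t, s))
    rw [show Sum.elim (fun _ => v (Sum.inl ())) (fun p => v (Sum.inr (p.1, p.2))) = v from
      Sum.elim_comp_inl_inr v] at this
    refine this.trans ⟨fun ⟨hy, hz, h⟩ => ⟨_, fun t => ⟨hy t, rfl⟩, hz, h.symm⟩, ?_⟩
    rintro ⟨y, hy, hz⟩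
    choose hy hy' using hy
    obtain rfl := funext hy'
    exact ⟨hy, hz.1, hz.2.symm⟩
  choose j hj using h2
  refine ⟨I, fun A => A.1.M, fun A => A.1.N, C, C', h1.of_twisted j ⟨θ', hj⟩, h1, ?_, ?_⟩
  · intro M
    obtain ⟨N, p, hp⟩ := hΓ M
    obtain ⟨M', q, hq⟩ := hΔ N
    obtain ⟨i, -⟩ := hθ M N M' p q hp hq
    obtain ⟨B, hB, -⟩ := hI ⟨M, N, p, _, hp, hq.comp_equiv i.symm⟩
    exact ⟨B, hB⟩
  · intro N
    obtain ⟨M, q, hq⟩ := hΔ N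
    obtain ⟨N', p, hp⟩ := hΓ M
    obtain ⟨i, -⟩ := hθ' N M N' q p hq hp
    obtain ⟨B, -, hB⟩ := hI ⟨M, N, _, q, hp.comp_equiv i.symm, hq⟩
    exact ⟨B, hB⟩

/-- The scheme that interprets every structure in itself, by itself. -/
def InterpScheme.refl (L : FirstOrder.Language.{u, v}) : InterpScheme L L where
  dim := 1
  dom := ⊤
  eqv := (Term.var (0, 0)).equal (Term.var (1, 0))
  func {k} F := (Term.func F fun j : Fin k => Term.var (j.castSucc, 0)).equal
    (Term.var (Fin.last k, 0))
  rel R := R.formula fun j => Term.var (j, 0)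

namespace InterpScheme

section Refl

variable {X : Type*} [L.Structure X]

theorem refl_dom_realize (x : Fin 1 → X) : (refl L).dom.Realize x :=
  Formula.realize_top.2 trivial

theorem refl_eqv_realize (v : Fin 2 × Fin 1 → X) :
    (refl L).eqv.Realize v ↔ v (0, 0) = v (1, 0) :=
  Formula.realize_equal

theorem refl_func_realize {k : ℕ} (F : L.Functions k) (v : Fin (k + 1) × Fin 1 → X) :
    ((refl L).func F).Realize v ↔
      Structure.funMap F (fun j : Fin k => v (j.castSucc, 0)) = v (Fin.last k, 0) :=
  Formula.realize_equal

theorem refl_rel_realize {k : ℕ} (R : L.Relations k) (v : Fin k × Fin 1 → X) :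
    ((refl L).rel R).Realize v ↔ Structure.RelMap R fun j => v (j, 0) :=
  Formula.realize_rel

/-- The coordinate maps of the trivial interpretation are the isomorphisms. -/
theorem IsCoordinateMap.exists_equiv {Y : Type*} [L.Structure Y]
    {f : (refl L).Domain X → Y} (hf : (refl L).IsCoordinateMap f) :
    ∃ e : X ≃[L] Y, ∀ x, e (x.1 (0 : Fin 1)) = f x := by
  let c : X → (refl L).Domain X := fun x => ⟨fun _ => x, refl_dom_realize _⟩
  have hc : ∀ x : (refl L).Domain X, c (x.1 (0 : Fin 1)) = x := fun x =>
    Subtype.ext (funext fun t => congrArg x.1 (Subsingleton.elim (α := Fin 1) _ _))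
  have hinj : Function.Injective fun x => f (c x) := fun x y h =>
    (refl_eqv_realize _).1 ((hf.eq_iff ![c x, c y]).1 h)
  have hsurj : Function.Surjective fun x => f (c x) := fun y => by
    obtain ⟨x, rfl⟩ := hf.surjective y
    exact ⟨_, congrArg f (hc x)⟩
  refine ⟨{ Equiv.ofBijective _ ⟨hinj, hsurj⟩ with map_fun' := ?_, map_rel' := ?_ },
    fun x => congrArg f (hc x)⟩
  · intro k F x
    have := (hf.func_iff F (Fin.snoc (α := fun _ => (refl L).Domain X)
      (fun j => c (x j)) (c (Structure.funMap F x)))).2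
        ((refl_func_realize F _).2 (by simp [c]))
    simp only [Fin.snoc_castSucc, Fin.snoc_last] at this
    exact this.symm
  · intro k R x
    exact (hf.rel_iff R fun j => c (x j)).trans (refl_rel_realize R _)

variable (X) in
theorem isCoordinateMap_refl :
    (refl L).IsCoordinateMap fun x : (refl L).Domain X => x.1 (0 : Fin 1) where
  surjective x := ⟨⟨fun _ => x, refl_dom_realize _⟩, rfl⟩
  eq_iff x := (refl_eqv_realize fun p => (x p.1).1 p.2).symm
  func_iff F x := (refl_func_realize F fun p => (x p.1).1 p.2).symm
  rel_iff R x := (refl_rel_realize R fun p => (x p.1).1 p.2).symm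

end Refl

end InterpScheme

theorem BiInterpretable.refl (T : L.Theory) : BiInterpretable T T := by
  have h : InterpScheme.DefinablyIsoToComposite T (InterpScheme.refl L) (InterpScheme.refl L) := by
    refine ⟨(Term.var (Sum.inl ())).equal (Term.var (Sum.inr ((0 : Fin 1), (0 : Fin 1)))), ?_⟩
    intro M N M' _ _ f g hf hg
    obtain ⟨e, he⟩ := hf.exists_equiv
    obtain ⟨e', he'⟩ := hg.exists_equiv
    refine ⟨e'.comp e, fun x y => Formula.realize_equal.trans ?_⟩
    have : ∀ (hy : ∀ j, (InterpScheme.refl L).dom.Realize (y j))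
        (hz : (InterpScheme.refl L).dom.Realize fun j => f ⟨y j, hy j⟩),
        g ⟨fun j => f ⟨y j, hy j⟩, hz⟩ = e' (e (y (0 : Fin 1) (0 : Fin 1))) := by
      intro hy hz
      exact (he' _).symm.trans (congrArg e' (he _).symm)
    simp only [this]
    exact ⟨fun h => ⟨fun _ => InterpScheme.refl_dom_realize _, InterpScheme.refl_dom_realize _,
      congrArg (fun z => e' (e z)) h⟩, fun ⟨_, _, h⟩ => e.injective (e'.injective h)⟩
  exact ⟨_, _, fun M => ⟨M, _, InterpScheme.isCoordinateMap_refl M⟩,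
    fun M => ⟨M, _, InterpScheme.isCoordinateMap_refl M⟩, h, h⟩

end BiInterp

/-! ### Finite approximations of `D_Φ` -/

namespace FormulaSeq

variable {L : FirstOrder.Language.{u, v}} (Φ : FormulaSeq L)

/-- The sequences that satisfy the first `n` of the conditions that define `D_Φ(M)`. Membership
depends on the first `n` entries only. -/
def DUpTo (n : ℕ) (M : Type*) [L.Structure M] : Set (ℕ → M) :=
  {a | ∀ k < n, ∀ y : M,
    (Φ k).Realize (Sum.elim (fun i : Fin k => a i) fun _ => y) →
      (Φ k).Realize (Sum.elim (fun i : Fin k => a i) fun _ => a k)}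

variable {Φ} {M : Type*} [L.Structure M] {a a' : ℕ → M} {m n : ℕ}

theorem mem_D_iff : a ∈ Φ.D M ↔ ∀ n, a ∈ Φ.DUpTo n M :=
  ⟨fun h _ k _ => h k, fun h k => h (k + 1) k k.lt_succ_self⟩

theorem DUpTo_anti (h : m ≤ n) (ha : a ∈ Φ.DUpTo n M) : a ∈ Φ.DUpTo m M :=
  fun k hk => ha k (hk.trans_le h)

theorem mem_DUpTo_congr (h : ∀ i < n, a' i = a i) (ha : a ∈ Φ.DUpTo n M) :
    a' ∈ Φ.DUpTo n M := by
  intro k hk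
  rw [show (fun i : Fin k => a' i) = fun i : Fin k => a i from
    funext fun i => h i (i.2.trans hk), h k hk]
  exact ha k hk

theorem update_mem_DUpTo (ha : a ∈ Φ.DUpTo n M) {x : M}
    (hx : ∀ y, (Φ n).Realize (Sum.elim (fun i : Fin n => a i) fun _ => y) →
      (Φ n).Realize (Sum.elim (fun i : Fin n => a i) fun _ => x)) :
    Function.update a n x ∈ Φ.DUpTo (n + 1) M := by
  have h : ∀ i < n, Function.update a n x i = a i := fun i hi =>
    Function.update_of_ne hi.ne _ _
  intro k hk
  rcases Nat.lt_succ_iff_lt_or_eq.1 hk with hk | rfl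
  · exact mem_DUpTo_congr h ha k hk
  · rw [show (fun i : Fin k => Function.update a k x i) = fun i : Fin k => a i from
      funext fun i => h i i.2, Function.update_self]
    exact hx

theorem exists_extend [Nonempty M] (hmn : m ≤ n) (ha : a ∈ Φ.DUpTo m M) :
    ∃ a' ∈ Φ.DUpTo n M, ∀ i < m, a' i = a i := by
  induction n, hmn using Nat.le_induction with
  | base => exact ⟨a, ha, fun _ _ => rfl⟩
  | succ n hn ih =>
    obtain ⟨a', ha', h⟩ := ih
    obtain ⟨x, hx⟩ : ∃ x, ∀ y, (Φ n).Realize (Sum.elim (fun i : Fin n => a' i) fun _ => y) →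
        (Φ n).Realize (Sum.elim (fun i : Fin n => a' i) fun _ => x) := by
      by_cases hy : ∃ y, (Φ n).Realize (Sum.elim (fun i : Fin n => a' i) fun _ => y)
      · exact ⟨_, fun _ _ => hy.choose_spec⟩
      · exact ⟨Classical.arbitrary M, fun y h => (hy ⟨y, h⟩).elim⟩
    exact ⟨_, update_mem_DUpTo ha' hx, fun i hi =>
      (Function.update_of_ne (hi.trans_le hn).ne _ _).trans (h i hi)⟩

theorem uniformlyDefinable_DUpTo {T : L.Theory} {I : Type*}
    (M : I → Theory.ModelType.{u, v, 0} T) (Φ : FormulaSeq L) (n : ℕ) :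
    UniformlyDefinable M fun i (v : Fin n → M i) =>
      ∃ a ∈ Φ.DUpTo n (M i), ∀ r : Fin n, a r = v r := by
  have h : ∀ k : Fin n, UniformlyDefinable M fun i (v : Fin n → M i) => ∀ y : Unit → M i,
      (Φ k).Realize (Sum.elim (fun j : Fin k => v (j.castLE k.2.le)) y) →
        (Φ k).Realize (Sum.elim (fun j : Fin k => v (j.castLE k.2.le)) fun _ => v k) := by
    intro k
    refine ⟨Formula.iAlls Unit (((Φ k).relabel (Sum.map (Fin.castLE k.2.le) id)).imp
      ((Φ k).relabel (Sum.elim (fun j => Sum.inl (j.castLE k.2.le)) fun _ => Sum.inl k))),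
      fun i v => ?_⟩
    rw [Formula.realize_iAlls]
    refine forall_congr' fun y => ?_
    rw [Formula.realize_imp, Formula.realize_relabel, Formula.realize_relabel]
    refine imp_congr (iff_of_eq (congrArg _ (funext fun z => ?_)))
      (iff_of_eq (congrArg _ (funext fun z => ?_))) <;> rcases z with z | z <;> rfl
  refine (UniformlyDefinable.forall_index h).congr fun i v => ?_
  constructor
  · intro h
    have hv : ∀ r (hr : r < n),
        (if hr : r < n then v ⟨r, hr⟩ else Classical.arbitrary (M i)) = v ⟨r, hr⟩ :=
      fun r hr => dif_pos hr
    refine ⟨fun r => if hr : r < n then v ⟨r, hr⟩ else Classical.arbitrary (M i),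
      fun k hk y hy => ?_, fun r => hv r r.2⟩
    have e : (fun j : Fin k => if hr : (j : ℕ) < n then v ⟨j, hr⟩ else Classical.arbitrary (M i)) =
        fun j : Fin k => v (j.castLE hk.le) := funext fun j => hv j (j.2.trans hk)
    simp only [e, hv k hk] at hy ⊢
    exact h ⟨k, hk⟩ _ hy
  · rintro ⟨a, ha, hav⟩ k y hy
    have e : (fun j : Fin k => v (j.castLE k.2.le)) = fun j : Fin k => a j :=
      funext fun j => (hav (j.castLE k.2.le)).symm
    rw [e] at hy ⊢
    rw [← hav k]
    exact ha k k.2 (y ()) hy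

theorem IsRich.exists_realize_iff (hΦ : Φ.IsRich) {k : ℕ} (ψ : L.Formula (Fin k ⊕ Unit)) :
    ∃ n, k ≤ n ∧ ∀ (M : Type) [L.Structure M] (a : ℕ → M) (y : M),
      (Φ n).Realize (Sum.elim (fun i : Fin n => a i) fun _ => y) ↔
        ψ.Realize (Sum.elim (fun i : Fin k => a i) fun _ => y) := by
  obtain ⟨n, hn, h⟩ := hΦ k ψ
  refine ⟨n, hn, fun M _ a y => ?_⟩
  rw [h, Formula.realize_relabel]
  refine iff_of_eq (congrArg _ (funext fun z => ?_))
  rcases z with z | z <;> rfl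

/-- For a rich sequence, witnesses of a formula `φ(x_{<m}, z)` for finitely many variables `z`
occur at fixed positions: for each of the variables one after the other, richness provides a
position at which the existence of values for the remaining ones is asked for. Conversely, any
witnesses may be placed there. -/
theorem IsRich.exists_positions (hΦ : Φ.IsRich) {m c : ℕ} (φ : L.Formula (Fin m ⊕ Fin c)) :
    ∃ (m' : ℕ) (k : Fin c → ℕ), m ≤ m' ∧ (∀ t, k t < m') ∧
      ∀ (M : Type) [L.Structure M] [Nonempty M],
        (∀ b ∈ Φ.DUpTo m' M, ∀ z, φ.Realize (Sum.elim (fun i : Fin m => b i) z) →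
          φ.Realize (Sum.elim (fun i : Fin m => b i) fun t => b (k t))) ∧
        ∀ b ∈ Φ.DUpTo m M, ∀ z, φ.Realize (Sum.elim (fun i : Fin m => b i) z) →
          ∃ b' ∈ Φ.DUpTo m' M, (∀ i < m, b' i = b i) ∧ ∀ t, b' (k t) = z t := by
  induction c generalizing m with
  | zero =>
    refine ⟨m, Fin.elim0, le_rfl, fun t => t.elim0, fun M _ _ => ⟨fun b _ z hz => ?_,
      fun b hb z _ => ⟨b, hb, fun _ _ => rfl, fun t => t.elim0⟩⟩⟩
    rwa [Subsingleton.elim z] at hz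
  | succ c ih =>
    obtain ⟨n, hmn, hn⟩ := hΦ.exists_realize_iff (k := m) (Formula.iExs (Fin c) (φ.relabel
      (Sum.elim (fun i => Sum.inl (Sum.inl i))
        (Fin.cons (α := fun _ => (Fin m ⊕ Unit) ⊕ Fin c) (Sum.inl (Sum.inr ())) Sum.inr))))
    have hn' : ∀ (M : Type) [L.Structure M] (b : ℕ → M) (y : M),
        (Φ n).Realize (Sum.elim (fun i : Fin n => b i) fun _ => y) ↔
          ∃ z : Fin c → M, φ.Realize (Sum.elim (fun i : Fin m => b i)
            (Fin.cons (α := fun _ => M) y z)) := by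
      intro M _ b y
      rw [hn, Formula.realize_iExs]
      refine exists_congr fun z => ?_
      rw [Formula.realize_relabel]
      refine iff_of_eq (congrArg _ (funext fun t => ?_))
      rcases t with t | t
      · rfl
      · refine Fin.cases ?_ (fun t => ?_) t <;> rfl
    obtain ⟨m', k, hm', hk, H⟩ := ih (m := n + 1) (φ.relabel
      (Sum.elim (fun i => Sum.inl (i.castLE (hmn.trans n.le_succ)))
        (Fin.cons (α := fun _ => Fin (n + 1) ⊕ Fin c) (Sum.inl (Fin.last n)) Sum.inr)))
    have hφ : ∀ (M : Type) [L.Structure M] (b : ℕ → M) (z : Fin c → M),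
        (φ.relabel (Sum.elim (fun i => Sum.inl (i.castLE (hmn.trans n.le_succ)))
          (Fin.cons (α := fun _ => Fin (n + 1) ⊕ Fin c) (Sum.inl (Fin.last n)) Sum.inr))).Realize
            (Sum.elim (fun i : Fin (n + 1) => b i) z) ↔
          φ.Realize (Sum.elim (fun i : Fin m => b i) (Fin.cons (α := fun _ => M) (b n) z)) := by
      intro M _ b z
      rw [Formula.realize_relabel]
      refine iff_of_eq (congrArg _ (funext fun t => ?_))
      rcases t with t | t
      · rfl
      · refine Fin.cases ?_ (fun t => ?_) t <;> rfl
    refine ⟨m', Fin.cons n k, (hmn.trans n.le_succ).trans hm', fun t => ?_, fun M _ _ => ⟨?_, ?_⟩⟩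
    · refine Fin.cases ?_ (fun t => ?_) t
      · exact hm'
      · exact hk t
    · intro b hb z hz
      obtain ⟨z', hz'⟩ := (hn' M b (b n)).1 (hb n hm' (z 0)
        ((hn' M b (z 0)).2 ⟨Fin.tail z, by rwa [Fin.cons_self_tail]⟩))
      have := (hφ M b _).1 ((H M).1 b hb z' ((hφ M b z').2 hz'))
      convert this using 3 with t
      refine Fin.cases ?_ (fun t => ?_) t <;> rfl
    · intro b hb z hz
      obtain ⟨b₁, hb₁, h₁⟩ := exists_extend hmn hb
      have e₁ : (fun i : Fin m => b₁ i) = fun i : Fin m => b i := funext fun i => h₁ i i.2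
      have hb₂ := update_mem_DUpTo hb₁ (x := z 0) fun _ _ =>
        (hn' M b₁ (z 0)).2 ⟨Fin.tail z, by rwa [Fin.cons_self_tail, e₁]⟩
      have h₂ : ∀ i < n, Function.update b₁ n (z 0) i = b₁ i := fun i hi =>
        Function.update_of_ne hi.ne _ _
      have e₂ : (fun i : Fin m => Function.update b₁ n (z 0) i) = fun i : Fin m => b i :=
        (funext fun i : Fin m => h₂ i (i.2.trans_le hmn)).trans e₁
      obtain ⟨b', hb', h', hz'⟩ := (H M).2 _ hb₂ (Fin.tail z)
        ((hφ M _ _).2 (by rwa [e₂, Function.update_self, Fin.cons_self_tail]))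
      refine ⟨b', hb', fun i hi => ?_, fun t => ?_⟩
      · rw [h' i ((hi.trans_le hmn).trans n.lt_succ_self), h₂ i (hi.trans_le hmn), h₁ i hi]
      · refine Fin.cases ?_ (fun t => ?_) t
        · exact (h' n n.lt_succ_self).trans (Function.update_self _ _ _)
        · exact hz' t

end FormulaSeq

/-! ### The back-and-forth construction -/

namespace UniformInterp

variable {L : FirstOrder.Language.{u, v}} {L' : FirstOrder.Language.{u', v'}}
  {T : L.Theory} {T' : L'.Theory} {I : Type*} {M : I → Theory.ModelType.{u, v, 0} T}
  {N : I → Theory.ModelType.{u', v', 0} T'}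

/-- A finite stage of the back-and-forth: coding an element of `N i` by the entries of `a` at the
positions `l j`, for each `j < m`, is a surjection from the sequences of length `n` in `M i` that
satisfy the first `n` conditions of `Φ` to the sequences of length `m` in `N i` that satisfy the
first `m` conditions of `Ψ`. The positions do not depend on `i`. -/
structure IsApprox (C : UniformInterp M N) (Φ : FormulaSeq L) (Ψ : FormulaSeq L') (n m : ℕ)
    (l : ℕ → Fin C.dim → ℕ) : Prop where
  lt : ∀ j < m, ∀ t, l j t < n
  exists_right : ∀ i, ∀ a ∈ Φ.DUpTo n (M i), ∃ b ∈ Ψ.DUpTo m (N i),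
    ∀ j < m, C.Codes i (fun t => a (l j t)) (b j)
  exists_left : ∀ i, ∀ b ∈ Ψ.DUpTo m (N i), ∃ a ∈ Φ.DUpTo n (M i),
    ∀ j < m, C.Codes i (fun t => a (l j t)) (b j)

/-- The back-and-forth step. The new coding, from `N` to `M`, is a section of the given one, from
`M` to `N`: as the fibres of the latter are definable, richness of `Ψ` provides positions at
which a code of a point of the fibre is found, and every point of the fibre can occur there. -/
theorem IsApprox.step {C : UniformInterp M N} {C' : UniformInterp N M}
    (hC : C.CompositeDefinable C') {Φ : FormulaSeq L} {Ψ : FormulaSeq L'} (hΨ : Ψ.IsRich)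
    {n m : ℕ} {l : ℕ → Fin C.dim → ℕ} (h : C.IsApprox Φ Ψ n m l) :
    ∃ m' k, m < m' ∧ C'.IsApprox Ψ Φ m' n k ∧ ∀ i, ∀ b ∈ Ψ.DUpTo m' (N i), ∀ a : ℕ → M i,
      (∀ r < n, C'.Codes i (fun s => b (k r s)) (a r)) →
        ∀ j < m, C.Codes i (fun t => a (l j t)) (b j) := by
  -- The tuple `v (Sum.inr ·)` codes a point of the fibre over `v (Sum.inl ·)`.
  have hdef : UniformlyDefinable N fun i (v : Fin m ⊕ Fin n × Fin C'.dim → N i) =>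
      (∃ a' : Fin n → M i, (∀ r, C'.Codes i (fun s => v (Sum.inr (r, s))) (a' r)) ∧
        ∃ a ∈ Φ.DUpTo n (M i), ∀ r : Fin n, a r = a' r) ∧
      ∀ j : Fin m, C.CodesTwice C' i
        (fun t s => v (Sum.inr (⟨l j t, h.lt j j.2 t⟩, s))) (v (Sum.inl j)) :=
    ((HasDefinablePreimage.of_uniformlyDefinable (C := C')
      (FormulaSeq.uniformlyDefinable_DUpTo M Φ n)).uniformlyDefinable.relabel Sum.inr).and
      (UniformlyDefinable.forall_index fun j => UniformlyDefinable.relabel hC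
        (Sum.elim (fun _ => Sum.inl j)
          fun z => Sum.inr ((⟨l j z.1, h.lt j j.2 z.1⟩ : Fin n), z.2)))
  have hS : ∀ i (b : ℕ → N i) (z : Fin n × Fin C'.dim → N i),
      ((∃ a' : Fin n → M i, (∀ r, C'.Codes i (fun s => z (r, s)) (a' r)) ∧
        ∃ a ∈ Φ.DUpTo n (M i), ∀ r : Fin n, a r = a' r) ∧
      ∀ j : Fin m, C.CodesTwice C' i (fun t s => z (⟨l j t, h.lt j j.2 t⟩, s)) (b j)) ↔
      ∃ a ∈ Φ.DUpTo n (M i), (∀ r : Fin n, C'.Codes i (fun s => z (r, s)) (a r)) ∧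
        ∀ j < m, C.Codes i (fun t => a (l j t)) (b j) := by
    intro i b z
    constructor
    · rintro ⟨⟨a', ha', a, ha, haa'⟩, hb⟩
      refine ⟨a, ha, fun r => by rw [haa']; exact ha' r, fun j hj => ?_⟩
      obtain ⟨y, hy, hy'⟩ := hb ⟨j, hj⟩
      rwa [show y = fun t => a (l j t) from funext fun t =>
        (hy t).unique (by rw [haa' ⟨_, h.lt j hj t⟩]; exact ha' _)] at hy'
    · rintro ⟨a, ha, haz, hab⟩
      exact ⟨⟨fun r => a r, haz, a, ha, fun _ => rfl⟩,
        fun j => ⟨_, fun t => haz ⟨_, h.lt j j.2 t⟩, hab j j.2⟩⟩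
  obtain ⟨φ, hφ⟩ := hdef
  obtain ⟨m', k, hm', hk, H⟩ := hΨ.exists_positions (φ.relabel (Sum.map id finProdFinEquiv))
  have hφ' : ∀ i (b : ℕ → N i) (z : Fin (n * C'.dim) → N i),
      (φ.relabel (Sum.map id finProdFinEquiv)).Realize (Sum.elim (fun j : Fin m => b j) z) ↔
        ∃ a ∈ Φ.DUpTo n (M i),
          (∀ r : Fin n, C'.Codes i (fun s => z (finProdFinEquiv (r, s))) (a r)) ∧
          ∀ j < m, C.Codes i (fun t => a (l j t)) (b j) := by
    intro i b z
    rw [Formula.realize_relabel, hφ]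
    exact hS i b fun p => z (finProdFinEquiv p)
  let k' : ℕ → Fin C'.dim → ℕ := fun r s =>
    if hr : r < n then k (finProdFinEquiv (⟨r, hr⟩, s)) else 0
  have hk' : ∀ r : Fin n, k' r = fun s => k (finProdFinEquiv (r, s)) := fun r =>
    funext fun s => dif_pos r.2
  have hfib : ∀ i, ∀ b ∈ Ψ.DUpTo m' (N i), ∃ a ∈ Φ.DUpTo n (M i),
      (∀ r < n, C'.Codes i (fun s => b (k' r s)) (a r)) ∧
        ∀ j < m, C.Codes i (fun t => a (l j t)) (b j) := by
    intro i b hb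
    obtain ⟨a, ha, hab⟩ := h.exists_left i b (FormulaSeq.DUpTo_anti hm' hb)
    choose z hz using fun r => C'.exists_codes i (a r)
    obtain ⟨a', ha', h1, h2⟩ := (hφ' i b _).1 ((H (N i)).1 b hb
      (fun p => z (finProdFinEquiv.symm p).1 (finProdFinEquiv.symm p).2)
      ((hφ' i b _).2 ⟨a, ha, fun r => by simpa using hz r, hab⟩))
    exact ⟨a', ha', fun r hr => by rw [hk' ⟨r, hr⟩]; exact h1 ⟨r, hr⟩, h2⟩
  refine ⟨m' + 1, k', Nat.lt_succ_of_le hm', ⟨fun r hr s => ?_, fun i b hb => ?_,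
    fun i a ha => ?_⟩, fun i b hb a hab j hj => ?_⟩
  · rw [hk' ⟨r, hr⟩]
    exact (hk _).trans m'.lt_succ_self
  · obtain ⟨a, ha, h1, -⟩ := hfib i b (FormulaSeq.DUpTo_anti m'.le_succ hb)
    exact ⟨a, ha, h1⟩
  · obtain ⟨b, hb, hab⟩ := h.exists_right i a ha
    choose z hz using fun r => C'.exists_codes i (a r)
    obtain ⟨b', hb', -, hbz⟩ := (H (N i)).2 b hb
      (fun p => z (finProdFinEquiv.symm p).1 (finProdFinEquiv.symm p).2)
      ((hφ' i b _).2 ⟨a, ha, fun r => by simpa using hz r, hab⟩)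
    obtain ⟨b'', hb'', h'⟩ := FormulaSeq.exists_extend m'.le_succ hb'
    refine ⟨b'', hb'', fun r hr => ?_⟩
    rw [hk' ⟨r, hr⟩]
    simp only [h' _ (hk _), hbz, Equiv.symm_apply_apply]
    exact hz r
  · obtain ⟨a', -, h1, h2⟩ := hfib i b (FormulaSeq.DUpTo_anti m'.le_succ hb)
    have : ∀ r < n, a r = a' r := fun r hr => (hab r hr).unique (h1 r hr)
    rw [show (fun t => a (l j t)) = fun t => a' (l j t) from
      funext fun t => this _ (h.lt j hj t)]
    exact h2 j hj

/-- A sequence of sequences that agree on longer and longer initial segments has a limit. -/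
theorem exists_limit {X : Type*} {m : ℕ → ℕ} (hm : StrictMono m) (c : ℕ → ℕ → X)
    (h : ∀ s, ∀ j < m s, c (s + 1) j = c s j) : ∃ d : ℕ → X, ∀ s, ∀ j < m s, d j = c s j := by
  have key : ∀ s s', s ≤ s' → ∀ j < m s, c s' j = c s j := by
    intro s s' hs j hj
    induction s', hs using Nat.le_induction with
    | base => rfl
    | succ s' hs ih => rw [h s' j (hj.trans_le (hm.monotone hs)), ih]
  refine ⟨fun j => c (j + 1) j, fun s j hj => ?_⟩
  rcases le_total s (j + 1) with hs | hs
  · exact key _ _ hs j hj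
  · exact (key _ _ hs j (j.lt_succ_self.trans_le hm.le_apply)).symm

/-- Two sequences in `D_Φ(M i)` and `D_Ψ(N i)` correspond to each other with respect to `l` and `k`
if each of the entries of one of them is coded by the entries of the other one at the positions
prescribed by `l` and `k`. -/
structure Correspond (C : UniformInterp M N) (C' : UniformInterp N M) (Φ : FormulaSeq L)
    (Ψ : FormulaSeq L') (l : ℕ → Fin C.dim → ℕ) (k : ℕ → Fin C'.dim → ℕ) (i : I) (a : ℕ → M i)
    (b : ℕ → N i) : Prop where
  mem_left : a ∈ Φ.D (M i)
  mem_right : b ∈ Ψ.D (N i)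
  codes : ∀ j, C.Codes i (fun t => a (l j t)) (b j)
  codes' : ∀ r, C'.Codes i (fun s => b (k r s)) (a r)

section Correspond

variable {C : UniformInterp M N} {C' : UniformInterp N M} {Φ : FormulaSeq L}
  {Ψ : FormulaSeq L'} {l : ℕ → Fin C.dim → ℕ} {k : ℕ → Fin C'.dim → ℕ} {i : I} {a : ℕ → M i}
  {b : ℕ → N i}

theorem Correspond.symm (h : C.Correspond C' Φ Ψ l k i a b) : C'.Correspond C Ψ Φ k l i b a :=
  ⟨h.mem_right, h.mem_left, h.codes', h.codes⟩

/-- As the entries of a member of `D_Ψ(N i)` form an elementary substructure, they include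
everything that is definable from them. -/
theorem Correspond.surjective (h : C.Correspond C' Φ Ψ l k i a b)
    (hC : C.CompositeDefinable C') (hΨ : Ψ.IsRich) (ha : Function.Surjective a) :
    Function.Surjective b := by
  intro x
  obtain ⟨χ, hχ⟩ := hC
  obtain ⟨y, hy⟩ := C.exists_codes i x
  choose p hp using fun t => ha (y t)
  have hx : C.CodesTwice C' i (fun t s => b (k (p t) s)) x :=
    ⟨y, fun t => hp t ▸ h.codes' (p t), hy⟩
  obtain ⟨K, hK⟩ : ∃ K, ∀ z : Fin C.dim × Fin C'.dim, k (p z.1) z.2 < K := by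
    obtain ⟨K, hK⟩ := (Set.finite_range fun z : Fin C.dim × Fin C'.dim => k (p z.1) z.2).bddAbove
    exact ⟨K + 1, fun z => Nat.lt_succ_of_le (hK ⟨z, rfl⟩)⟩
  obtain ⟨n, -, hn⟩ := hΨ.exists_realize_iff (k := K)
    (χ.relabel (Sum.elim Sum.inr fun z => Sum.inl ⟨_, hK z⟩))
  have hn' : ∀ x, (Ψ n).Realize (Sum.elim (fun j : Fin n => b j) fun _ => x) ↔
      C.CodesTwice C' i (fun t s => b (k (p t) s)) x := by
    intro x
    rw [hn, Formula.realize_relabel, hχ]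
    rfl
  exact ⟨n, ((hn' _).1 (h.mem_right n x ((hn' x).2 hx))).unique hx⟩

end Correspond

/-- The limit of the back-and-forth: a bijection between `D_Φ(M i)` and `D_Ψ(N i)`, given by
positions that do not depend on `i`. -/
theorem exists_correspond {C : UniformInterp M N} {C' : UniformInterp N M}
    (hC : C.CompositeDefinable C') (hC' : C'.CompositeDefinable C) {Φ : FormulaSeq L}
    {Ψ : FormulaSeq L'} (hΦ : Φ.IsRich) (hΨ : Ψ.IsRich) :
    ∃ l k, ∀ i, (∀ a ∈ Φ.D (M i), ∃ b, C.Correspond C' Φ Ψ l k i a b) ∧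
      ∀ b ∈ Ψ.D (N i), ∃ a, C.Correspond C' Φ Ψ l k i a b := by
  let S := {X : ℕ × ℕ × (ℕ → Fin C.dim → ℕ) // C.IsApprox Φ Ψ X.1 X.2.1 X.2.2}
  have hstep : ∀ X : S, ∃ (Y : S) (k : ℕ → Fin C'.dim → ℕ),
      X.1.1 < Y.1.1 ∧ X.1.2.1 < Y.1.2.1 ∧
      (∀ i, ∀ b ∈ Ψ.DUpTo Y.1.2.1 (N i), ∃ a ∈ Φ.DUpTo X.1.1 (M i),
        ∀ r < X.1.1, C'.Codes i (fun s => b (k r s)) (a r)) ∧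
      (∀ i, ∀ b ∈ Ψ.DUpTo Y.1.2.1 (N i), ∀ a : ℕ → M i,
        (∀ r < X.1.1, C'.Codes i (fun s => b (k r s)) (a r)) →
          ∀ j < X.1.2.1, C.Codes i (fun t => a (X.1.2.2 j t)) (b j)) ∧
      ∀ i, ∀ a ∈ Φ.DUpTo Y.1.1 (M i), ∀ b : ℕ → N i,
        (∀ j < Y.1.2.1, C.Codes i (fun t => a (Y.1.2.2 j t)) (b j)) →
          ∀ r < X.1.1, C'.Codes i (fun s => b (k r s)) (a r) := by
    rintro ⟨⟨n, m, l⟩, h⟩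
    obtain ⟨m', k, hm, h', hk⟩ := h.step hC hΨ
    obtain ⟨n', l', hn, h'', hl⟩ := h'.step hC' hΦ
    exact ⟨⟨⟨n', m', l'⟩, h''⟩, k, hn, hm, h'.exists_right, hk, hl⟩
  choose next k hn hm hex hkl hlk using hstep
  let X : ℕ → S := fun s => Nat.rec
    ⟨⟨0, 0, fun _ _ => 0⟩, by simp, fun i _ _ => ⟨fun _ => Classical.arbitrary (N i), by
      simp [FormulaSeq.DUpTo], by simp⟩, fun i _ _ => ⟨fun _ => Classical.arbitrary (M i), by
      simp [FormulaSeq.DUpTo], by simp⟩⟩ (fun _ => next) s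
  let n : ℕ → ℕ := fun s => (X s).1.1
  let m : ℕ → ℕ := fun s => (X s).1.2.1
  have hn' : StrictMono n := strictMono_nat_of_lt_succ fun s => hn (X s)
  have hm' : StrictMono m := strictMono_nat_of_lt_succ fun s => hm (X s)
  have hlim : ∀ {m : ℕ → ℕ}, StrictMono m → ∀ j, j < m (j + 1) := fun hm j =>
    j.lt_succ_self.trans_le hm.le_apply
  refine ⟨fun j => (X (j + 1)).1.2.2 j, fun r => k (X (r + 1)) r, fun i => ⟨?_, ?_⟩⟩
  · intro a ha
    rw [FormulaSeq.mem_D_iff] at ha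
    choose c hc hac using fun s => (X s).2.exists_right i a (ha _)
    obtain ⟨b, hb⟩ := exists_limit hm' c fun s j hj =>
      (hkl (X s) i (c (s + 1)) (hc (s + 1)) a
        (hlk (X s) i a (ha _) _ (hac (s + 1))) j hj).unique (hac s j hj)
    have hab : ∀ s, ∀ j < m s, C.Codes i (fun t => a ((X s).1.2.2 j t)) (b j) := fun s j hj => by
      rw [hb s j hj]
      exact hac s j hj
    refine ⟨b, FormulaSeq.mem_D_iff.2 ha, FormulaSeq.mem_D_iff.2 fun s => ?_,
      fun j => hab (j + 1) j (hlim hm' j), fun r => ?_⟩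
    · exact FormulaSeq.DUpTo_anti hm'.le_apply (FormulaSeq.mem_DUpTo_congr (hb s) (hc s))
    · exact hlk (X (r + 1)) i a (ha _) b (hab (r + 2)) r (hlim hn' r)
  · intro b hb
    rw [FormulaSeq.mem_D_iff] at hb
    choose c hc hbc using fun s => hex (X s) i b (hb _)
    obtain ⟨a, ha⟩ := exists_limit hn' c fun s r hr =>
      (hlk (X s) i (c (s + 1)) (hc (s + 1)) b
        (hkl (X (s + 1)) i b (hb _) _ (hbc (s + 1))) r hr).unique (hbc s r hr)
    have hab : ∀ s, ∀ r < n s, C'.Codes i (fun t => b (k (X s) r t)) (a r) := fun s r hr => by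
      rw [ha s r hr]
      exact hbc s r hr
    refine ⟨a, FormulaSeq.mem_D_iff.2 fun s => ?_, FormulaSeq.mem_D_iff.2 hb, fun j => ?_,
      fun r => hab (r + 1) r (hlim hn' r)⟩
    · exact FormulaSeq.DUpTo_anti hn'.le_apply (FormulaSeq.mem_DUpTo_congr (ha s) (hc s))
    · exact hkl (X (j + 1)) i b (hb _) a (hab (j + 1)) j (hlim hm' j)

end UniformInterp

/-! ### The isomorphism of groupoids -/

namespace UniformInterp

variable {L : FirstOrder.Language.{u, v}} {L' : FirstOrder.Language.{u', v'}}
  {T : L.Theory} {T' : L'.Theory} {I : Type*} {M : I → Theory.ModelType.{u, v, 0} T}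
  {N : I → Theory.ModelType.{u', v', 0} T'} {C : UniformInterp M N} {C' : UniformInterp N M}
  {Φ : FormulaSeq L} {Ψ : FormulaSeq L'} {l : ℕ → Fin C.dim → ℕ} {k : ℕ → Fin C'.dim → ℕ}

variable (C C' l k) in
/-- The correspondence between `G_Φ(T)` and `G_Ψ(T')` that takes `tp(a, b)` to `tp(c, d)` whenever
`a`, `b` are enumerations of `M i` and correspond to the enumerations `c`, `d` of `N i`. -/
def TypeRel (g : GPhi T Φ) (h : GPhi T' Ψ) : Prop :=
  ∃ (i : I) (a b : ℕ → M i) (c d : ℕ → N i),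
    Function.Surjective a ∧ Function.Surjective b ∧ Function.Surjective c ∧ Function.Surjective d ∧
      C.Correspond C' Φ Ψ l k i a c ∧ C.Correspond C' Φ Ψ l k i b d ∧
        (g : T.CompleteType (ℕ ⊕ ℕ)) = pairType T (M i) a b ∧
          (h : T'.CompleteType (ℕ ⊕ ℕ)) = pairType T' (N i) c d

theorem TypeRel.symm {g : GPhi T Φ} {h : GPhi T' Ψ} (H : C.TypeRel C' l k g h) :
    C'.TypeRel C k l h g := by
  obtain ⟨i, a, b, c, d, ha, hb, hc, hd, hac, hbd, hg, hh⟩ := H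
  exact ⟨i, c, d, a, b, hc, hd, ha, hb, hac.symm, hbd.symm, hh, hg⟩

theorem exists_typeRel (hC : C.CompositeDefinable C') (hΨ : Ψ.IsRich)
    (hM : Function.Surjective M)
    (hlk : ∀ i, ∀ a ∈ Φ.D (M i), ∃ b, C.Correspond C' Φ Ψ l k i a b) (g : GPhi T Φ) :
    ∃ h : GPhi T' Ψ, C.TypeRel C' l k g h := by
  obtain ⟨M', a, b, ha, hb, hDa, hDb, hg⟩ := GPhi.exists_rep g
  obtain ⟨i, rfl⟩ := hM M'
  obtain ⟨c, hac⟩ := hlk i a hDa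
  obtain ⟨d, hbd⟩ := hlk i b hDb
  have hc := hac.surjective hC hΨ ha
  have hd := hbd.surjective hC hΨ hb
  exact ⟨⟨pairType T' (N i) c d, N i, c, d, hc, hd, hac.mem_right, hbd.mem_right, rfl⟩,
    i, a, b, c, d, ha, hb, hc, hd, hac, hbd, hg, rfl⟩

/-- The formulas of the image are translated, uniformly, into formulas of the preimage. -/
theorem exists_box_iff (φ : L'.Formula (ℕ ⊕ ℕ)) :
    ∃ ψ : L.Formula (ℕ ⊕ ℕ), ∀ (g : GPhi T Φ) (h : GPhi T' Ψ), C.TypeRel C' l k g h →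
      (g ∈ GPhi.box ψ ↔ h ∈ GPhi.box φ) := by
  obtain ⟨ψ, hψ⟩ := HasDefinablePreimage.of_uniformlyDefinable (C := C)
    (S := fun i v => φ.Realize v) ⟨φ, fun _ _ => Iff.rfl⟩
  refine ⟨ψ.relabel fun z => z.1.map (fun j => l j z.2) fun j => l j z.2, ?_⟩
  rintro g h ⟨i, a, b, c, d, -, -, -, -, hac, hbd, hg, hh⟩
  rw [GPhi.mem_box hg, GPhi.mem_box hh, Formula.realize_relabel]
  refine hψ i _ _ ?_
  rintro (j | j)
  · exact hac.codes j
  · exact hbd.codes j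

theorem TypeRel.unique {g : GPhi T Φ} {h h' : GPhi T' Ψ} (H : C.TypeRel C' l k g h)
    (H' : C.TypeRel C' l k g h') : h = h' := by
  refine Subtype.ext ?_
  obtain ⟨N₁, a, b, -, -, -, -, e⟩ := GPhi.exists_rep h
  obtain ⟨N₂, a', b', -, -, -, -, e'⟩ := GPhi.exists_rep h'
  rw [e, e']
  refine GPhi.typeOf_eq_iff.2 fun φ => ?_
  obtain ⟨ψ, hψ⟩ := exists_box_iff (C := C) (C' := C') (Φ := Φ) (Ψ := Ψ) (l := l) (k := k) φ
  rw [← GPhi.mem_box e, ← GPhi.mem_box e', ← hψ g h H, ← hψ g h' H']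

theorem TypeRel.inv {g : GPhi T Φ} {h : GPhi T' Ψ} (H : C.TypeRel C' l k g h) :
    C.TypeRel C' l k (GPhi.inv g) (GPhi.inv h) := by
  obtain ⟨i, a, b, c, d, ha, hb, hc, hd, hac, hbd, hg, hh⟩ := H
  exact ⟨i, b, a, d, c, hb, ha, hd, hc, hbd, hac, GPhi.inv_rep g hg, GPhi.inv_rep h hh⟩

theorem TypeRel.isComp (hC : C.CompositeDefinable C') (hΨ : Ψ.IsRich)
    (hM : Function.Surjective M)
    (hlk : ∀ i, ∀ a ∈ Φ.D (M i), ∃ b, C.Correspond C' Φ Ψ l k i a b)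
    {g₁ g₂ g₃ : GPhi T Φ} {h₁ h₂ h₃ : GPhi T' Ψ} (H₁ : C.TypeRel C' l k g₁ h₁)
    (H₂ : C.TypeRel C' l k g₂ h₂) (H₃ : C.TypeRel C' l k g₃ h₃) (H : GPhi.IsComp g₁ g₂ g₃) :
    GPhi.IsComp h₁ h₂ h₃ := by
  obtain ⟨M', a, b, c, ha, hb, hc, e₁, e₂, e₃⟩ := H
  obtain ⟨i, rfl⟩ := hM M'
  obtain ⟨a', haa'⟩ := hlk i a (GPhi.mem_D_left g₁ ha e₁)
  obtain ⟨b', hbb'⟩ := hlk i b (GPhi.mem_D_right g₁ hb e₁)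
  obtain ⟨c', hcc'⟩ := hlk i c (GPhi.mem_D_right g₂ hc e₂)
  have ha' := haa'.surjective hC hΨ ha
  have hb' := hbb'.surjective hC hΨ hb
  have hc' := hcc'.surjective hC hΨ hc
  have key : ∀ {g : GPhi T Φ} {h : GPhi T' Ψ} {x y : ℕ → M i} {x' y' : ℕ → N i},
      Function.Surjective x → Function.Surjective y → Function.Surjective x' →
      Function.Surjective y' → C.Correspond C' Φ Ψ l k i x x' →
      C.Correspond C' Φ Ψ l k i y y' → (g : T.CompleteType (ℕ ⊕ ℕ)) = pairType T (M i) x y →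
      C.TypeRel C' l k g h → (h : T'.CompleteType (ℕ ⊕ ℕ)) = pairType T' (N i) x' y' := by
    intro g h x y x' y' hx hy hx' hy' hxx' hyy' e H
    exact congrArg Subtype.val (H.unique (h' := ⟨pairType T' (N i) x' y', N i, x', y', hx', hy',
      hxx'.mem_right, hyy'.mem_right, rfl⟩) ⟨i, x, y, x', y', hx, hy, hx', hy', hxx', hyy', e, rfl⟩)
  exact ⟨N i, a', b', c', ha', hb', hc', key ha hb ha' hb' haa' hbb' e₁ H₁,
    key hb hc hb' hc' hbb' hcc' e₂ H₂, key ha hc ha' hc' haa' hcc' e₃ H₃⟩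

theorem continuous_of_typeRel {F : GPhi T Φ → GPhi T' Ψ} (hF : ∀ g, C.TypeRel C' l k g (F g)) :
    Continuous F := by
  refine GPhi.continuous_of_box fun φ => ?_
  obtain ⟨ψ, hψ⟩ := exists_box_iff (C := C) (C' := C') (Φ := Φ) (Ψ := Ψ) (l := l) (k := k) φ
  rw [show F ⁻¹' GPhi.box φ = GPhi.box ψ from Set.ext fun g => (hψ g _ (hF g)).symm]
  exact GPhi.isOpen_box ψ

theorem nonempty_topGroupoidIso (hC : C.CompositeDefinable C') (hC' : C'.CompositeDefinable C)
    (hM : Function.Surjective M) (hN : Function.Surjective N) (hΦ : Φ.IsRich) (hΨ : Ψ.IsRich) :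
    Nonempty (TopGroupoidIso (GPhi T Φ) (GPhi T' Ψ)) := by
  obtain ⟨l, k, hlk⟩ := exists_correspond hC hC' hΦ hΨ
  have h₁ : ∀ i, ∀ a ∈ Φ.D (M i), ∃ b, C.Correspond C' Φ Ψ l k i a b := fun i => (hlk i).1
  have h₂ : ∀ i, ∀ b ∈ Ψ.D (N i), ∃ a, C'.Correspond C Ψ Φ k l i b a := fun i b hb =>
    ((hlk i).2 b hb).imp fun _ h => h.symm
  choose F hF using exists_typeRel hC hΨ hM h₁
  choose G hG using exists_typeRel hC' hΦ hN h₂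
  have hGF : ∀ g, G (F g) = g := fun g => (hG _).unique (hF g).symm
  have hFG : ∀ h, F (G h) = h := fun h => (hF _).unique (hG h).symm
  refine ⟨{ toFun := F, invFun := G, left_inv := hGF, right_inv := hFG,
            continuous_toFun := continuous_of_typeRel hF
            continuous_invFun := continuous_of_typeRel hG
            map_comp := fun f g => ?_
            map_inv := fun g => (hF _).unique (hF g).inv }⟩
  change GPhi.comp (F f) (F g) = (GPhi.comp f g).map F
  refine Option.ext fun h => ?_
  rw [Option.map_eq_some_iff, GPhi.comp_eq_some_iff]
  constructor
  · intro H
    exact ⟨G h, GPhi.comp_eq_some_iff.2 (TypeRel.isComp hC' hΦ hN h₂ (hF f).symm (hF g).symm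
      (hG h) H), hFG h⟩
  · rintro ⟨e, he, rfl⟩
    exact TypeRel.isComp hC hΨ hM h₁ (hF f) (hF g) (hF e) (GPhi.comp_eq_some_iff.1 he)

end UniformInterp

theorem BiInterpretable.nonempty_topGroupoidIso {L : FirstOrder.Language.{u, v}}
    {L' : FirstOrder.Language.{u', v'}} {T : L.Theory} {T' : L'.Theory}
    (h : BiInterpretable T T') {Φ : FormulaSeq L} {Ψ : FormulaSeq L'} (hΦ : Φ.IsRich)
    (hΨ : Ψ.IsRich) : Nonempty (TopGroupoidIso (GPhi T Φ) (GPhi T' Ψ)) := by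
  obtain ⟨I, M, N, C, C', hC, hC', hM, hN⟩ := h.exists_uniformInterp
  exact UniformInterp.nonempty_topGroupoidIso hC hC' hM hN hΦ hΨ

theorem mainTheorem3 {L : FirstOrder.Language.{u, v}} {L' : FirstOrder.Language.{u', v'}}
    [Countable L.Symbols] [Countable L'.Symbols]
    (T : L.Theory) (T' : L'.Theory) (hT : T.IsComplete) (hT' : T'.IsComplete)
    (hne : ∀ M : Theory.ModelType.{u, v, 0} T, Nontrivial M)
    (hne' : ∀ M : Theory.ModelType.{u', v', 0} T', Nontrivial M) :
    (BiInterpretable T T' →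
      ∀ (Φ : FormulaSeq L) (Ψ : FormulaSeq L'), Φ.IsRich → Ψ.IsRich →
        Nonempty (TopGroupoidIso (GPhi T Φ) (GPhi T' Ψ))) ∧
    (∀ Φ Φ' : FormulaSeq L, Φ.IsRich → Φ'.IsRich →
        Nonempty (TopGroupoidIso (GPhi T Φ) (GPhi T Φ'))) := by
  exact ⟨fun h _ _ hΦ hΨ => h.nonempty_topGroupoidIso hΦ hΨ,
    fun _ _ hΦ hΦ' => (BiInterpretable.refl T).nonempty_topGroupoidIso hΦ hΦ'⟩
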